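/- Let $m_1,m_2\in\mathbb N$, $m=m_1+m_2$, $l>0$, $M>0$, and $\mathbb C_M=\{z\in\mathbb C:\Im z>M\}$. Let $\|\cdot\|$ denote the operator norm of matrices with respect to the Euclidean norms. Let $v,\widehat v$ be measurable $m_1\times m_2$ complex matrix functions on $[0,l]$ with $$\max(\|v(x)\|,\|\widehat v(x)\|)\le M,\qquad 0<x<l .$$ For such a potential $v$ consider the skew-self-adjoint Dirac system $$\frac{d}{dx}y(x,z)=\big(\mathrm i z j+jV(x)\big)y(x,z),\qquad j=\begin{bmatrix}I_{m_1}&0\\0&-I_{m_2}\end{bmatrix},\quad V=\begin{bmatrix}0&v\\v^*&0\end{bmatrix}$$ on $[0,l]$, and let $u(x,z)$ be its $m\times m$ fundamental solution, that is, the absolutely continuous solution (the equation holding for almost every $x$) normalized by $u(0,z)=I_m$. Let $\mathcal N(l,z)$, $z\in\mathbb C_M$, be the set of values at $z$ of $$\begin{bmatrix}0&I_{m_2}\end{bmatrix}u(l,z)^{-1}\mathcal P(z)\Big(\begin{bmatrix}I_{m_1}&0\end{bmatrix}u(l,z)^{-1}\mathcal P(z)\Big)^{-1},$$ where $\mathcal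 P$ runs through the $m\times m_1$ matrix functions that are meromorphic in the open upper half-plane and satisfy $\mathcal P^*\mathcal P>0$ and $\mathcal P^*j\mathcal P\ge 0$ in $\mathbb C_M$ outside a discrete set of exceptional points, and $z$ is a point of analyticity of $\mathcal P$ at which both inequalities hold. A Weyl function of the system on $[0,l]$ is an analytic $m_2\times m_1$ matrix function $\varphi$ on $\mathbb C_M$ such that $\varphi(z)\in\mathcal N(l,z)$ for all $z\in\mathbb C_M$. **Theorem.** Let $\varphi$ and $\widehat\varphi$ be Weyl functions on $[0,l]$ of the Dirac systems with potentials $v$ and $\widehat v$, respectively. Let $0<r_0\le l$ and $c\in\mathbb R$, and suppose that on the ray $\Re z=c\,\Im z$, $\Im z>0$, $$\|\varphi(z)-\widehat\varphi(z)\|=O\big(\mathrm e^{2\mathrm i rz}\big)\quad(\Im z\to\infty)\qquad\text{for all } 0<r<r_0,$$ where the implied constant may depend on $r$. Then $v(x)=\widehat v(x)$ for almost every $x\in(0,r_0)$. -/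

import Mathlib

open Set Filter Topology MeasureTheory Asymptotics
-- Matrices carry the operator norm induced by the Euclidean norms.
open scoped Matrix Matrix.Norms.L2Operator ComplexOrder

namespace SkewDirac

/-- The signature matrix `j = diag (I_{m₁}, -I_{m₂})`. -/
def jMat (m₁ m₂ : ℕ) : Matrix (Fin m₁ ⊕ Fin m₂) (Fin m₁ ⊕ Fin m₂) ℂ :=
  Matrix.fromBlocks 1 0 0 (-1)

/-- The matrix `V = [[0, v], [v*, 0]]` built from a value `v` of the potential. -/
def VMat {m₁ m₂ : ℕ} (v : Matrix (Fin m₁) (Fin m₂) ℂ) :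
    Matrix (Fin m₁ ⊕ Fin m₂) (Fin m₁ ⊕ Fin m₂) ℂ :=
  Matrix.fromBlocks 0 v vᴴ 0

/-- A bounded measurable potential: `v` is Lebesgue measurable on `(0, l)` and
`‖v x‖ ≤ M` for `0 < x < l`. -/
structure IsBoundedPotential {m₁ m₂ : ℕ} (l M : ℝ)
    (v : ℝ → Matrix (Fin m₁) (Fin m₂) ℂ) : Prop where
  measurable : ∀ i k, AEMeasurable (fun x => v x i k) (volume.restrict (Ioo 0 l))
  bound : ∀ x ∈ Ioo 0 l, ‖v x‖ ≤ M

/-- `u` is the (Carathéodory) solution on `[0, l]` of the initial value problem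
`y' = (i z j + j V) y`, `y 0 = I_m`, in integrated form. For bounded measurable `v` and continuous
`u` the integrand is integrable, so this says that `u` is absolutely continuous, satisfies the
differential equation almost everywhere, and `u 0 = I_m`; there is exactly one such `u`. -/
structure IsFundamentalSolution {m₁ m₂ : ℕ} (l : ℝ) (v : ℝ → Matrix (Fin m₁) (Fin m₂) ℂ) (z : ℂ)
    (u : ℝ → Matrix (Fin m₁ ⊕ Fin m₂) (Fin m₁ ⊕ Fin m₂) ℂ) : Prop where
  continuousOn : ContinuousOn u (Icc 0 l)
  eq : ∀ x ∈ Icc 0 l, u x =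
    1 + ∫ t in (0 : ℝ)..x, ((Complex.I * z) • jMat m₁ m₂ + jMat m₁ m₂ * VMat (v t)) * u t

/-- The open half-plane `ℂ_M = {z | Im z > M}`. -/
def halfPlane (M : ℝ) : Set ℂ := {z | M < z.im}

/-- The two pointwise inequalities `Q* Q > 0` and `Q* j Q ≥ 0` for an `m × m₁` matrix `Q`. -/
def IsNonsingularJNonneg {m₁ m₂ : ℕ} (Q : Matrix (Fin m₁ ⊕ Fin m₂) (Fin m₁) ℂ) : Prop :=
  (Qᴴ * Q).PosDef ∧ (Qᴴ * jMat m₁ m₂ * Q).PosSemidef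

/-- The class of nonsingular `m × m₁` matrix functions with property-`j`: meromorphic in the open
upper half-plane, and satisfying `P* P > 0`, `P* j P ≥ 0` at all points of `ℂ_M` outside a discrete
set. -/
structure HasPropertyJ {m₁ m₂ : ℕ} (M : ℝ) (P : ℂ → Matrix (Fin m₁ ⊕ Fin m₂) (Fin m₁) ℂ) :
    Prop where
  meromorphic : MeromorphicOn P (halfPlane 0)
  nonneg : ∀ᶠ z in codiscreteWithin (halfPlane M), IsNonsingularJNonneg (P z)

/-- The Möbius transformation `[0 I] U⁻¹ Q ([I 0] U⁻¹ Q)⁻¹`. -/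
noncomputable def mobius {m₁ m₂ : ℕ} (U : Matrix (Fin m₁ ⊕ Fin m₂) (Fin m₁ ⊕ Fin m₂) ℂ)
    (Q : Matrix (Fin m₁ ⊕ Fin m₂) (Fin m₁) ℂ) : Matrix (Fin m₂) (Fin m₁) ℂ :=
  ((Matrix.fromCols 0 1 : Matrix (Fin m₂) (Fin m₁ ⊕ Fin m₂) ℂ) * U⁻¹ * Q) *
    ((Matrix.fromCols 1 0 : Matrix (Fin m₁) (Fin m₁ ⊕ Fin m₂) ℂ) * U⁻¹ * Q)⁻¹

/-- The set `𝒩` at a fixed point `z`: the values at `z` of the Möbius transformations with matrix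
`U = u(x, z)` of the functions with property-`j` (for which `z` is not an exceptional point). -/
def mobiusSet {m₁ m₂ : ℕ} (M : ℝ) (U : Matrix (Fin m₁ ⊕ Fin m₂) (Fin m₁ ⊕ Fin m₂) ℂ) (z : ℂ) :
    Set (Matrix (Fin m₂) (Fin m₁) ℂ) :=
  {W | ∃ P : ℂ → Matrix (Fin m₁ ⊕ Fin m₂) (Fin m₁) ℂ, HasPropertyJ M P ∧
    AnalyticAt ℂ P z ∧ IsNonsingularJNonneg (P z) ∧ W = mobius U (P z)}

/-- `φ` is a Weyl function on `[0, l]` of the Dirac system with potential `v` bounded by `M`: it is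
analytic in `ℂ_M` and `φ z ∈ 𝒩(l, z)` for all `z ∈ ℂ_M`. -/
def IsWeylFunction {m₁ m₂ : ℕ} (l M : ℝ) (v : ℝ → Matrix (Fin m₁) (Fin m₂) ℂ)
    (φ : ℂ → Matrix (Fin m₂) (Fin m₁) ℂ) : Prop :=
  AnalyticOnNhd ℂ φ (halfPlane M) ∧
  ∃ u : ℝ → ℂ → Matrix (Fin m₁ ⊕ Fin m₂) (Fin m₁ ⊕ Fin m₂) ℂ,
    (∀ z, IsFundamentalSolution l v z (fun x => u x z)) ∧
    ∀ z ∈ halfPlane M, φ z ∈ mobiusSet M (u l z) z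

/-- The filter `Im z → ∞` along the ray `Re z = c * Im z`. -/
def rayAtInfty (c : ℝ) : Filter ℂ :=
  comap Complex.im atTop ⊓ 𝓟 {z | z.re = c * z.im}

end SkewDirac

/-!
The idea is to compare the two systems through the transfer operator
`T(x, z) = û(x, z) u(x, z)⁻¹`, where `u` and `û` are the fundamental solutions. Because of the
Lagrange identity `u(x, z̄)* u(x, z) = 1`, the inverse equals `u(x, z̄)*`, so `T(x, ·)` is entire,
and `‖T(x, z)‖ ≤ exp (2 x |Im z|)` (`norm_transfer_le`); in particular it is bounded on the real line.

On the given ray it is bounded as well (`exists_norm_transfer_le_on_ray`). For `Im z ≥ 5 M` every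
initial value splits as `(p + φ p) + h` with `J p = p` and `J h = -h`. By the Weyl property the
solution starting at `p + φ p` stays in the cone `⟨J y, y⟩ ≥ 0` up to `l`, and it decays like
`exp (-x Im z)`, up to factors `exp (± M x)`; the one starting at `h` stays in a narrow cone around
the eigenspace `J = -1` and grows like `exp (x Im z)`. The second system has the same rates, and
replacing `φ` by `φ̂` costs a growing solution with initial value `(φ - φ̂) p`, that is, a factor
`exp (2 x Im z) ‖φ - φ̂‖`, which the hypothesis bounds for `x < r₀`. All these rates come from the
differential inequalities for the pair `‖y‖²`, `⟨J y, y⟩` collected in `IsEnergyPair`. Since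
`T(x, z̄)*` is the transfer operator with the two systems interchanged, the conjugate ray is covered
too.

The real line and the two rays cut the plane into four sectors of opening less than `π`, so the
Phragmén–Lindelöf principle and Liouville's theorem make `T(x, ·)` constant
(`apply_eq_apply_of_bounded_on_rays`). The differential equation of `T` in `x`, at two values of
`z`, then gives `T = 1` on `(0, r₀)` and hence equality of the potentials
(`potential_eq_of_transfer_eq`).

The argument is carried out for operators on a Hilbert space with a signature operator `J`; matrices
enter only through `Matrix.toEuclideanCLM`, an isometric star-algebra isomorphism.
-/

namespace SkewDirac

/-! ### Lipschitz functions with a prescribed derivative almost everywhere -/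

section Calculus

variable {E F G : Type*} [NormedAddCommGroup E] [NormedSpace ℝ E] [NormedAddCommGroup F]
  [NormedSpace ℝ F] [NormedAddCommGroup G] [NormedSpace ℝ G] {l : ℝ}

/-- `f` is Lipschitz on `[0, l]` and has derivative `f'` at almost every point of `(0, l)`. Bounded
coefficients make every Carathéodory solution such a function. -/
structure LipAEDeriv (l : ℝ) (f f' : ℝ → E) : Prop where
  lip : ∃ K, LipschitzOnWith K f (Icc 0 l)
  deriv : ∀ᵐ x : ℝ, x ∈ Ioo 0 l → HasDerivAt f (f' x) x

namespace LipAEDeriv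

lemma congr_deriv {f f' g' : ℝ → E} (hf : LipAEDeriv l f f')
    (h : ∀ᵐ x : ℝ, x ∈ Ioo 0 l → f' x = g' x) : LipAEDeriv l f g' where
  lip := hf.lip
  deriv := by
    filter_upwards [hf.deriv, h] with x hx hx' hxl
    exact hx' hxl ▸ hx hxl

lemma congr {f g f' : ℝ → E} (hf : LipAEDeriv l f f') (h : EqOn g f (Icc 0 l)) :
    LipAEDeriv l g f' where
  lip := by
    obtain ⟨K, hK⟩ := hf.lip
    exact ⟨K, fun x hx y hy => by rw [h hx, h hy]; exact hK hx hy⟩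
  deriv := by
    filter_upwards [hf.deriv] with x hx hxl
    refine (hx hxl).congr_of_eventuallyEq ?_
    filter_upwards [Ioo_mem_nhds hxl.1 hxl.2] with y hy using h (Ioo_subset_Icc_self hy)

lemma continuousOn {f f' : ℝ → E} (hf : LipAEDeriv l f f') : ContinuousOn f (Icc 0 l) := by
  obtain ⟨K, hK⟩ := hf.lip
  exact hK.continuousOn

lemma mono {f f' : ℝ → E} {x : ℝ} (hf : LipAEDeriv l f f') (hx : x ≤ l) : LipAEDeriv x f f' where
  lip := by
    obtain ⟨K, hK⟩ := hf.lip
    exact ⟨K, hK.mono (Icc_subset_Icc_right hx)⟩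
  deriv := by
    filter_upwards [hf.deriv] with y hy hyx
    exact hy (Ioo_subset_Ioo_right hx hyx)

lemma clm {f f' : ℝ → E} (hf : LipAEDeriv l f f') (A : E →L[ℝ] F) :
    LipAEDeriv l (fun x => A (f x)) (fun x => A (f' x)) where
  lip := by
    obtain ⟨K, hK⟩ := hf.lip
    exact ⟨_, A.lipschitz.comp_lipschitzOnWith hK⟩
  deriv := by
    filter_upwards [hf.deriv] with x hx hxl
    exact A.hasFDerivAt.comp_hasDerivAt x (hx hxl)

lemma add {f f' g g' : ℝ → E} (hf : LipAEDeriv l f f') (hg : LipAEDeriv l g g') :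
    LipAEDeriv l (fun x => f x + g x) (fun x => f' x + g' x) where
  lip := by
    obtain ⟨K, hK⟩ := hf.lip
    obtain ⟨K', hK'⟩ := hg.lip
    exact ⟨_, hK.add hK'⟩
  deriv := by
    filter_upwards [hf.deriv, hg.deriv] with x hx hx' hxl
    exact (hx hxl).add (hx' hxl)

/-- The product rule for a continuous bilinear map. -/
lemma bilin {f f' : ℝ → E} {g g' : ℝ → F} (hf : LipAEDeriv l f f') (hg : LipAEDeriv l g g')
    (B : E →L[ℝ] F →L[ℝ] G) :
    LipAEDeriv l (fun x => B (f x) (g x)) (fun x => B (f x) (g' x) + B (f' x) (g x)) where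
  lip := by
    obtain ⟨K, hK⟩ := hf.lip
    obtain ⟨K', hK'⟩ := hg.lip
    obtain ⟨C, hC⟩ := isCompact_Icc.exists_bound_of_continuousOn hK.continuousOn
    obtain ⟨C', hC'⟩ := isCompact_Icc.exists_bound_of_continuousOn hK'.continuousOn
    refine ⟨Real.toNNReal (‖B‖ * |C| * K' + ‖B‖ * K * |C'|), ?_⟩
    refine LipschitzOnWith.of_dist_le_mul fun x hx y hy => ?_
    have h1 : dist (f x) (f y) ≤ K * dist x y := hK.dist_le_mul x hx y hy
    have h2 : dist (g x) (g y) ≤ K' * dist x y := hK'.dist_le_mul x hx y hy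
    have h3 : ‖f x‖ ≤ |C| := (hC x hx).trans (le_abs_self _)
    have h4 : ‖g y‖ ≤ |C'| := (hC' y hy).trans (le_abs_self _)
    rw [Real.coe_toNNReal _ (by positivity)]
    rw [dist_eq_norm] at h1 h2 ⊢
    have : B (f x) (g x) - B (f y) (g y) = B (f x) (g x - g y) + B (f x - f y) (g y) := by
      simp
    rw [this]
    calc _ ≤ ‖B (f x) (g x - g y)‖ + ‖B (f x - f y) (g y)‖ := norm_add_le _ _
      _ ≤ ‖B‖ * ‖f x‖ * ‖g x - g y‖ + ‖B‖ * ‖f x - f y‖ * ‖g y‖ :=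
        add_le_add (B.le_opNorm₂ _ _) (B.le_opNorm₂ _ _)
      _ ≤ ‖B‖ * |C| * (K' * dist x y) + ‖B‖ * (K * dist x y) * |C'| := by gcongr
      _ = _ := by ring
  deriv := by
    filter_upwards [hf.deriv, hg.deriv] with x hx hx' hxl
    exact B.hasDerivAt_of_bilinear (fun _ => hx hxl) (fun _ => hx' hxl)

/-- A primitive of a bounded measurable function. -/
lemma integral [CompleteSpace E] {g : ℝ → E} {C : ℝ}
    (hg : AEStronglyMeasurable g (volume.restrict (Ioo 0 l)))
    (hC : ∀ x ∈ Ioo 0 l, ‖g x‖ ≤ C) : LipAEDeriv l (fun x => ∫ t in (0 : ℝ)..x, g t) g := by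
  rcases lt_or_ge l 0 with hl | hl
  · exact ⟨⟨0, by simp [Icc_eq_empty_of_lt hl]⟩, by simp [Ioo_eq_empty_of_le hl.le]⟩
  have hint : IntegrableOn g (Ioo 0 l) := by
    refine IntegrableOn.of_bound (by simp) hg C ?_
    exact (ae_restrict_iff' measurableSet_Ioo).2 (Eventually.of_forall hC)
  have hint' : IntervalIntegrable g volume 0 l := by
    rw [intervalIntegrable_iff_integrableOn_Ioo_of_le hl]
    exact hint
  refine ⟨⟨Real.toNNReal |C|, LipschitzOnWith.of_dist_le_mul fun x hx y hy => ?_⟩, ?_⟩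
  · rw [Real.coe_toNNReal _ (abs_nonneg _), dist_eq_norm,
      intervalIntegral.integral_interval_sub_left, Real.dist_eq]
    · refine intervalIntegral.norm_integral_le_of_norm_le_const_ae ?_
      have : ∀ᵐ t : ℝ, t ≠ l := by simp [ae_iff]
      filter_upwards [this] with t ht htxy
      refine (hC t ⟨?_, ?_⟩).trans (le_abs_self _)
      · exact lt_of_le_of_lt (le_min hy.1 hx.1) htxy.1
      · exact lt_of_le_of_ne (htxy.2.trans (max_le hy.2 hx.2)) ht
    · exact hint'.mono_set (by rw [uIcc_of_le hl, uIcc_of_le hx.1]; exact Icc_subset_Icc_right hx.2)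
    · exact hint'.mono_set (by rw [uIcc_of_le hl, uIcc_of_le hy.1]; exact Icc_subset_Icc_right hy.2)
  · filter_upwards [hint'.ae_hasDerivAt_integral] with x hx hxl
    rw [uIcc_of_le hl] at hx
    exact hx (Ioo_subset_Icc_self hxl) 0 ⟨le_rfl, hl⟩

lemma eq_of_deriv_eq_zero {f : ℝ → E} (hf : LipAEDeriv l f (fun _ => 0)) {x : ℝ}
    (hx : x ∈ Icc 0 l) : f x = f 0 := by
  have hl : 0 ≤ l := hx.1.trans hx.2
  obtain ⟨K, hK⟩ := hf.lip
  have hac : AbsolutelyContinuousOnInterval f 0 l :=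
    LipschitzOnWith.absolutelyContinuousOnInterval (by rwa [uIcc_of_le hl])
  obtain ⟨C, hC⟩ := hac.const_of_ae_hasDerivAt_zero (by
    have h1 : ∀ᵐ t : ℝ, t ≠ l := by simp [ae_iff]
    have h2 : ∀ᵐ t : ℝ, t ≠ 0 := by simp [ae_iff]
    rw [uIcc_of_le hl]
    filter_upwards [hf.deriv, h1, h2] with x hx h1 h2 hxl
    exact hx ⟨lt_of_le_of_ne hxl.1 (Ne.symm h2), lt_of_le_of_ne hxl.2 h1⟩)
  rw [uIcc_of_le hl] at hC
  rw [hC x hx, hC 0 ⟨le_rfl, hl⟩]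

lemma monotoneOn {f f' : ℝ → ℝ} (hf : LipAEDeriv l f f')
    (h : ∀ᵐ x : ℝ, x ∈ Ioo 0 l → 0 ≤ f' x) : MonotoneOn f (Icc 0 l) := by
  intro a ha b hb hab
  obtain ⟨K, hK⟩ := hf.lip
  have hac : AbsolutelyContinuousOnInterval f a b :=
    LipschitzOnWith.absolutelyContinuousOnInterval
      (by rw [uIcc_of_le hab]; exact hK.mono (Icc_subset_Icc ha.1 hb.2))
  have h0 : 0 ≤ ∫ x in a..b, _root_.deriv f x := by
    rw [intervalIntegral.integral_of_le hab, integral_Ioc_eq_integral_Ioo]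
    refine setIntegral_nonneg_of_ae_restrict ?_
    rw [EventuallyLE, ae_restrict_iff' measurableSet_Ioo]
    filter_upwards [hf.deriv, h] with x hx hx' hxab
    have hxl : x ∈ Ioo 0 l := Ioo_subset_Ioo ha.1 hb.2 hxab
    rw [(hx hxl).deriv]
    exact hx' hxl
  rw [hac.integral_deriv_eq_sub] at h0
  linarith

lemma exp (κ : ℝ) : LipAEDeriv l (fun x => Real.exp (κ * x)) (fun x => κ * Real.exp (κ * x)) where
  lip := by
    have : ContDiff ℝ 1 (fun x : ℝ => Real.exp (κ * x)) := by fun_prop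
    exact this.contDiffOn.exists_lipschitzOnWith (by decide) (convex_Icc _ _) isCompact_Icc
  deriv := Eventually.of_forall fun x _ => by
    have := ((hasDerivAt_id x).const_mul κ).exp
    simpa [mul_comm] using this

lemma exp_mul (κ : ℝ) {f f' : ℝ → ℝ} (hf : LipAEDeriv l f f') :
    LipAEDeriv l (fun x => Real.exp (κ * x) * f x)
      (fun x => Real.exp (κ * x) * (f' x + κ * f x)) := by
  refine ((LipAEDeriv.exp κ).bilin hf (ContinuousLinearMap.mul ℝ ℝ)).congr_deriv ?_
  refine Eventually.of_forall fun x _ => ?_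
  simp only [ContinuousLinearMap.mul_apply']
  ring

end LipAEDeriv

end Calculus

/-! ### Evolution operators -/

section Evolution

open scoped ComplexConjugate

variable {H : Type*} [NormedAddCommGroup H] [InnerProductSpace ℂ H]

/-- The coefficient `i z J + J V` of the system. -/
noncomputable def gen (J : H →L[ℂ] H) (V : ℝ → H →L[ℂ] H) (z : ℂ) (x : ℝ) : H →L[ℂ] H :=
  (Complex.I * z) • J + J * V x

/-- `U` is the evolution operator on `[0, l]` of the system at the spectral parameter `z`,
normalized to `1` at `0`. -/
structure IsEvolution (J : H →L[ℂ] H) (l : ℝ) (V : ℝ → H →L[ℂ] H) (z : ℂ)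
    (U : ℝ → H →L[ℂ] H) : Prop where
  continuousOn : ContinuousOn U (Icc 0 l)
  eq : ∀ x ∈ Icc 0 l, U x = 1 + ∫ t in (0 : ℝ)..x, gen J V z t * U t

variable {J : H →L[ℂ] H} {l M : ℝ} {V V' : ℝ → H →L[ℂ] H} {z w : ℂ} {U U' : ℝ → H →L[ℂ] H}

lemma IsEvolution.zero (hU : IsEvolution J l V z U) (hl : 0 ≤ l) : U 0 = 1 := by
  rw [hU.eq 0 ⟨le_rfl, hl⟩]; simp

variable [CompleteSpace H]

/-- The coefficient data of a skew-self-adjoint Dirac system on a Hilbert space: a signature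
operator `J`, and a bounded measurable self-adjoint potential `V` anticommuting with `J`. -/
structure IsDiracData (J : H →L[ℂ] H) (l M : ℝ) (V : ℝ → H →L[ℂ] H) : Prop where
  star_J : star J = J
  J_mul_J : J * J = 1
  star_V : ∀ x, star (V x) = V x
  anti : ∀ x, J * V x = -(V x * J)
  meas : AEStronglyMeasurable V (volume.restrict (Ioo 0 l))
  bound : ∀ x ∈ Ioo 0 l, ‖V x‖ ≤ M

lemma IsDiracData.star_gen (hV : IsDiracData J l M V) (z : ℂ) (x : ℝ) :
    star (gen J V z x) = -gen J V (conj z) x := by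
  simp only [gen, star_add, star_smul, star_mul, hV.star_J, hV.star_V]
  simp [hV.anti, add_comm, mul_comm]

lemma IsEvolution.lipAEDeriv (hU : IsEvolution J l V z U) (hV : IsDiracData J l M V) :
    LipAEDeriv l U (fun x => gen J V z x * U x) := by
  obtain ⟨C, hC⟩ := isCompact_Icc.exists_bound_of_continuousOn hU.continuousOn
  have h : LipAEDeriv l (fun x => ∫ t in (0 : ℝ)..x, gen J V z t * U t)
      (fun x => gen J V z x * U x) := by
    refine LipAEDeriv.integral (C := (‖(Complex.I * z) • J‖ + ‖J‖ * M) * |C|) ?_ fun x hx => ?_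
    · refine AEStronglyMeasurable.mul ?_ ((hU.continuousOn.mono
        Ioo_subset_Icc_self).aestronglyMeasurable measurableSet_Ioo)
      exact aestronglyMeasurable_const.add (hV.meas.const_mul J)
    · refine (norm_mul_le _ _).trans (mul_le_mul ?_ ?_ (norm_nonneg _) ?_)
      · refine (norm_add_le _ _).trans (add_le_add le_rfl ((norm_mul_le _ _).trans ?_))
        exact mul_le_mul_of_nonneg_left (hV.bound x hx) (norm_nonneg _)
      · exact (hC x (Ioo_subset_Icc_self hx)).trans (le_abs_self _)
      · have := (norm_nonneg _).trans (hV.bound x hx)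
        positivity
  have h2 := (show LipAEDeriv l (fun _ : ℝ => (1 : H →L[ℂ] H)) (fun _ => 0) from
    ⟨⟨0, LipschitzWith.const _ |>.lipschitzOnWith⟩,
      Eventually.of_forall fun x _ => hasDerivAt_const _ _⟩).add h
  exact (h2.congr hU.eq).congr_deriv (Eventually.of_forall fun x _ => zero_add _)

/-- The product rule in the operator algebra. -/
lemma LipAEDeriv.mul {f f' g g' : ℝ → H →L[ℂ] H} (hf : LipAEDeriv l f f')
    (hg : LipAEDeriv l g g') :
    LipAEDeriv l (fun x => f x * g x) (fun x => f x * g' x + f' x * g x) :=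
  hf.bilin hg (ContinuousLinearMap.mul ℝ (H →L[ℂ] H))

lemma IsEvolution.lipAEDeriv_star (hU : IsEvolution J l V z U) (hV : IsDiracData J l M V) :
    LipAEDeriv l (fun x => star (U x)) (fun x => -(star (U x) * gen J V (conj z) x)) := by
  have := (hU.lipAEDeriv hV).clm
    ((starL' ℝ : (H →L[ℂ] H) ≃L[ℝ] (H →L[ℂ] H)) : (H →L[ℂ] H) →L[ℝ] (H →L[ℂ] H))
  refine this.congr_deriv (Eventually.of_forall fun x _ => ?_)
  simp [hV.star_gen]

/-- The Lagrange identity for two spectral parameters. -/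
lemma IsEvolution.star_mul (hU : IsEvolution J l V (conj z) U) (hV : IsDiracData J l M V)
    (hU' : IsEvolution J l V w U') {x : ℝ} (hx : x ∈ Icc 0 l) :
    star (U x) * U' x =
      1 + (Complex.I * (w - z)) • ∫ t in (0 : ℝ)..x, star (U t) * J * U' t := by
  have hl := hx.1.trans hx.2
  have hcont : ContinuousOn (fun t => star (U t) * J * U' t) (Icc 0 l) :=
    (hU.continuousOn.star.mul continuousOn_const).mul hU'.continuousOn
  obtain ⟨C, hC⟩ := isCompact_Icc.exists_bound_of_continuousOn hcont
  have h1 := (LipAEDeriv.integral ((hcont.mono Ioo_subset_Icc_self).aestronglyMeasurable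
    measurableSet_Ioo) (fun t ht => hC t (Ioo_subset_Icc_self ht))).clm
      ((-(Complex.I * (w - z))) • ContinuousLinearMap.id ℝ (H →L[ℂ] H))
  have h2 := ((hU.lipAEDeriv_star hV).mul (hU'.lipAEDeriv hV)).add h1
  have h3 := (h2.congr_deriv (g' := fun _ => 0) (Eventually.of_forall fun t _ => ?_)
    ).eq_of_deriv_eq_zero hx
  · simp only [hU.zero hl, hU'.zero hl, _root_.smul_apply,
      ContinuousLinearMap.id_apply, intervalIntegral.integral_same, star_one, mul_one,
      smul_zero, add_zero, neg_smul] at h3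
    rw [← h3]; abel
  · simp only [gen, _root_.smul_apply, ContinuousLinearMap.id_apply,
      Complex.conj_conj, mul_add, add_mul, smul_mul_assoc, mul_smul_comm, neg_smul, mul_assoc,
      mul_sub, sub_smul, neg_add, neg_mul]
    abel

lemma IsEvolution.star_mul_self (hU : IsEvolution J l V (conj z) U) (hV : IsDiracData J l M V)
    (hU' : IsEvolution J l V z U') {x : ℝ} (hx : x ∈ Icc 0 l) :
    star (U x) * U' x = 1 := by
  rw [hU.star_mul hV hU' hx]; simp

lemma IsEvolution.mul_star_self [FiniteDimensional ℂ H] (hU : IsEvolution J l V (conj z) U)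
    (hV : IsDiracData J l M V) (hU' : IsEvolution J l V z U') {x : ℝ} (hx : x ∈ Icc 0 l) :
    U' x * star (U x) = 1 := by
  have h := hU.star_mul_self hV hU' hx
  have h' : ((star (U x) : H →L[ℂ] H) : H →ₗ[ℂ] H) * (U' x : H →ₗ[ℂ] H) = 1 := by
    ext y
    exact congr($h y)
  rw [mul_eq_one_comm] at h'
  ext y
  exact congr($h' y)

end Evolution

/-! ### The two energies of a solution -/

section ScalarEnergy

/-- The scalar system satisfied by `n = ‖y‖²` and `s = ⟨J y, y⟩` for a solution `y` at a spectral
parameter with imaginary part `η`. The function `p` stands for `⟨V y, y⟩`. -/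
structure IsEnergyPair (l M η : ℝ) (n s p : ℝ → ℝ) : Prop where
  deriv_n : LipAEDeriv l n (fun x => -(2 * η * s x))
  deriv_s : LipAEDeriv l s (fun x => -(2 * η * n x) + 2 * p x)
  abs_p_le : ∀ x ∈ Ioo 0 l, |p x| ≤ M * n x
  abs_s_le : ∀ x, |s x| ≤ n x

namespace IsEnergyPair

variable {l M η : ℝ} {n s p : ℝ → ℝ}

/-- Linear combinations of the two energies with an exponential weight. -/
lemma weighted (h : IsEnergyPair l M η n s p) (κ a b : ℝ) :
    LipAEDeriv l (fun x => Real.exp (κ * x) * (a * n x + b * s x))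
      (fun x => Real.exp (κ * x) * (a * (-(2 * η * s x)) + b * (-(2 * η * n x) + 2 * p x) +
        κ * (a * n x + b * s x))) := by
  have h1 := h.deriv_n.clm (a • ContinuousLinearMap.id ℝ ℝ)
  have h2 := h.deriv_s.clm (b • ContinuousLinearMap.id ℝ ℝ)
  exact (h1.add h2).exp_mul κ

lemma monotoneOn_weighted (h : IsEnergyPair l M η n s p) (κ a b : ℝ)
    (hd : ∀ x ∈ Ioo 0 l, |p x| ≤ M * n x → |s x| ≤ n x →
      0 ≤ a * (-(2 * η * s x)) + b * (-(2 * η * n x) + 2 * p x) + κ * (a * n x + b * s x)) :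
    MonotoneOn (fun x => Real.exp (κ * x) * (a * n x + b * s x)) (Icc 0 l) :=
  (h.weighted κ a b).monotoneOn (Eventually.of_forall fun x hx =>
    mul_nonneg (Real.exp_nonneg _) (hd x hx (h.abs_p_le x hx) (h.abs_s_le x)))

lemma n_nonneg (h : IsEnergyPair l M η n s p) (x : ℝ) : 0 ≤ n x :=
  (abs_nonneg _).trans (h.abs_s_le x)

lemma n_le (h : IsEnergyPair l M η n s p) {x : ℝ} (hx : x ∈ Icc 0 l) :
    n x ≤ Real.exp (2 * |η| * x) * n 0 := by
  have h1 := h.monotoneOn_weighted (-(2 * |η|)) (-1) 0 (fun y _ _ hs => by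
    have : |η * s y| ≤ |η| * n y := by
      rw [abs_mul]; exact mul_le_mul_of_nonneg_left hs (abs_nonneg _)
    nlinarith [neg_abs_le (η * s y)]) ⟨le_rfl, hx.1.trans hx.2⟩ hx hx.1
  simp only [mul_zero, Real.exp_zero, zero_mul, add_zero, neg_mul, one_mul, mul_neg,
    neg_le_neg_iff] at h1
  rw [Real.exp_neg, inv_mul_le_iff₀ (Real.exp_pos _)] at h1
  exact h1

/-- Above the threshold `M` the indefinite energy decreases. -/
lemma s_antitoneOn (h : IsEnergyPair l M η n s p) (hη : M ≤ η) : AntitoneOn s (Icc 0 l) := by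
  have h1 := h.monotoneOn_weighted 0 0 (-1) (fun x _ hp hs => by
    have := h.n_nonneg x
    nlinarith [abs_le.1 hp])
  intro x hx y hy hxy
  have := h1 hx hy hxy
  simpa using this

lemma s_nonneg (h : IsEnergyPair l M η n s p) (hη : M ≤ η) (hl : 0 ≤ s l) {x : ℝ}
    (hx : x ∈ Icc 0 l) : 0 ≤ s x :=
  hl.trans (h.s_antitoneOn hη hx ⟨hx.1.trans hx.2, le_rfl⟩ hx.2)

/-- `(n + s) / 2` is the squared norm of the component in the eigenspace `J = 1`; in the nonnegative
cone it dominates `n / 2`, which bounds the effect of the potential by the rate `2 M`. -/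
lemma add_le_of_nonneg (h : IsEnergyPair l M η n s p) (hM : 0 ≤ M) (hη : M ≤ η) (hl : 0 ≤ s l) {x : ℝ}
    (hx : x ∈ Icc 0 l) : n x + s x ≤ Real.exp (-(2 * (η - M) * x)) * (n 0 + s 0) := by
  have h1 := h.monotoneOn_weighted (2 * (η - M)) (-1) (-1) (fun y hy hp hs => by
    have := h.s_nonneg hη hl (Ioo_subset_Icc_self hy)
    nlinarith [abs_le.1 hp, mul_nonneg hM this]) ⟨le_rfl, hx.1.trans hx.2⟩ hx hx.1
  simp only [mul_zero, Real.exp_zero] at h1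
  rw [Real.exp_neg, ← div_eq_inv_mul, le_div_iff₀ (Real.exp_pos _)]
  linarith

lemma le_add_of_nonneg (h : IsEnergyPair l M η n s p) (hM : 0 ≤ M) (hη : M ≤ η) (hl : 0 ≤ s l) {x : ℝ}
    (hx : x ∈ Icc 0 l) : n 0 + s 0 ≤ Real.exp (2 * (η + M) * x) * (n x + s x) := by
  have h1 := h.monotoneOn_weighted (2 * (η + M)) 1 1 (fun y hy hp hs => by
    have := h.s_nonneg hη hl (Ioo_subset_Icc_self hy)
    nlinarith [abs_le.1 hp, mul_nonneg hM this]) ⟨le_rfl, hx.1.trans hx.2⟩ hx hx.1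
  simp only [mul_zero, Real.exp_zero, one_mul] at h1
  exact h1

/-- A solution which starts in the negative cone stays uniformly inside it. -/
lemma s_le_of_neg (h : IsEnergyPair l M η n s p) (hM : 0 ≤ M) (hη : 5 * M ≤ η) (h0 : s 0 = -n 0)
    {x : ℝ} (hx : x ∈ Icc 0 l) : s x ≤ -(4 / 5 * n x) := by
  -- The combination `-s - κ n` increases as soon as `M ≤ (1 - κ) η`.
  have h1 := h.monotoneOn_weighted 0 (-(4 / 5)) (-1) (fun y hy hp hs => by
    have := h.n_nonneg y
    have hη0 : 0 ≤ η := by linarith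
    nlinarith [abs_le.1 hp, mul_le_mul_of_nonneg_left (abs_le.1 hs).1 hη0])
    ⟨le_rfl, hx.1.trans hx.2⟩ hx hx.1
  simp only [mul_zero, Real.exp_zero, zero_mul, one_mul] at h1
  have := h.n_nonneg 0
  linarith

/-- `(n - s) / 2` is the squared norm of the component in the eigenspace `J = -1`. -/
lemma sub_le_of_neg (h : IsEnergyPair l M η n s p) (hM : 0 ≤ M) (hη : 5 * M ≤ η) (h0 : s 0 = -n 0)
    {x : ℝ} (hx : x ∈ Icc 0 l) : n x - s x ≤ Real.exp (2 * (η + M) * x) * (2 * n 0) := by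
  have h1 := h.monotoneOn_weighted (-(2 * (η + M))) (-1) 1 (fun y hy hp hs => by
    have := h.s_le_of_neg hM hη h0 (Ioo_subset_Icc_self hy)
    nlinarith [abs_le.1 hp, mul_nonneg hM (h.n_nonneg y), mul_le_mul_of_nonneg_left this hM])
    ⟨le_rfl, hx.1.trans hx.2⟩ hx hx.1
  simp only [mul_zero, Real.exp_zero, one_mul, neg_mul, Real.exp_neg, h0] at h1
  rw [← div_le_iff₀' (Real.exp_pos _), div_eq_inv_mul]
  linarith

lemma le_sub_of_neg (h : IsEnergyPair l M η n s p) (hM : 0 ≤ M) (hη : 5 * M ≤ η) (h0 : s 0 = -n 0)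
    {x : ℝ} (hx : x ∈ Icc 0 l) : 2 * n 0 ≤ Real.exp (-(2 * (η - M) * x)) * (n x - s x) := by
  have h1 := h.monotoneOn_weighted (-(2 * (η - M))) 1 (-1) (fun y hy hp hs => by
    have := h.s_le_of_neg hM hη h0 (Ioo_subset_Icc_self hy)
    nlinarith [abs_le.1 hp, mul_nonneg hM (h.n_nonneg y), mul_le_mul_of_nonneg_left this hM])
    ⟨le_rfl, hx.1.trans hx.2⟩ hx hx.1
  simp only [mul_zero, Real.exp_zero, one_mul, neg_mul, h0, ← sub_eq_add_neg] at h1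
  linarith

end IsEnergyPair

end ScalarEnergy

section Energy

open scoped ComplexConjugate InnerProductSpace

variable {H : Type*} [NormedAddCommGroup H] [InnerProductSpace ℂ H]

/-- The real part of the inner product as a continuous real-bilinear map. -/
noncomputable def reInner : H →L[ℝ] H →L[ℝ] ℝ :=
  LinearMap.mkContinuous₂
    (LinearMap.mk₂ ℝ (fun x y : H => (⟪x, y⟫_ℂ).re) (fun x y z => by simp)
      (fun c x y => by simp [← Complex.coe_smul, mul_comm])
      (fun x y z => by simp)
      (fun c x y => by simp [← Complex.coe_smul])) 1
    (fun x y => by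
      simpa using (Complex.abs_re_le_norm _).trans (norm_inner_le_norm (𝕜 := ℂ) x y))

lemma reInner_apply (x y : H) : reInner x y = (⟪x, y⟫_ℂ).re := rfl

lemma reInner_comm (x y : H) : reInner x y = reInner y x := by
  rw [reInner_apply, reInner_apply, ← inner_conj_symm, Complex.conj_re]

lemma reInner_self (x : H) : reInner x x = ‖x‖ ^ 2 := by
  rw [reInner_apply, inner_self_eq_norm_sq_to_K]
  norm_cast

variable [CompleteSpace H] {J : H →L[ℂ] H} {l M : ℝ} {V V' : ℝ → H →L[ℂ] H} {z w : ℂ}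
  {U U' : ℝ → H →L[ℂ] H}

namespace IsDiracData

lemma inner_J_left (hV : IsDiracData J l M V) (x y : H) : ⟪J x, y⟫_ℂ = ⟪x, J y⟫_ℂ := by
  have := ContinuousLinearMap.adjoint_inner_left J y x
  rwa [← ContinuousLinearMap.star_eq_adjoint, hV.star_J] at this

lemma J_J (hV : IsDiracData J l M V) (x : H) : J (J x) = x := congr($hV.J_mul_J x)

lemma norm_J (hV : IsDiracData J l M V) (x : H) : ‖J x‖ = ‖x‖ := by
  rw [← sq_eq_sq₀ (norm_nonneg _) (norm_nonneg _), ← reInner_self, ← reInner_self, reInner_apply,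
    hV.inner_J_left, hV.J_J, reInner_apply]

lemma inner_V_left (hV : IsDiracData J l M V) (t : ℝ) (x y : H) :
    ⟪V t x, y⟫_ℂ = ⟪x, V t y⟫_ℂ := by
  have := ContinuousLinearMap.adjoint_inner_left (V t) y x
  rwa [← ContinuousLinearMap.star_eq_adjoint, hV.star_V] at this

lemma reInner_gen (hV : IsDiracData J l M V) (t : ℝ) (y : H) :
    reInner y (gen J V z t y) = -(z.im * reInner (J y) y) := by
  have h1 : reInner y (J (V t y)) = 0 := by
    have h2 : J (V t y) = -(V t (J y)) := congr($(hV.anti t) y)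
    have h3 : reInner y (J (V t y)) = reInner y (V t (J y)) := by
      rw [reInner_comm, reInner_apply, reInner_apply, hV.inner_J_left, hV.inner_V_left]
    have h4 := congr(reInner y $h2)
    rw [map_neg] at h4
    linarith
  have h2 : (⟪J y, y⟫_ℂ).im = 0 := by
    rw [← Complex.conj_eq_iff_im, inner_conj_symm, hV.inner_J_left]
  have h3 : gen J V z t y = (Complex.I * z) • J y + J (V t y) := rfl
  rw [h3, map_add, h1, add_zero, reInner_apply, inner_smul_right, ← hV.inner_J_left, reInner_apply]
  simp [h2]

lemma reInner_J_gen (hV : IsDiracData J l M V) (t : ℝ) (y : H) :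
    reInner (J y) (gen J V z t y) = -(z.im * ‖y‖ ^ 2) + reInner y (V t y) := by
  have h3 : gen J V z t y = (Complex.I * z) • J y + J (V t y) := rfl
  rw [h3, map_add, reInner_apply, inner_smul_right, reInner_apply (J y), hV.inner_J_left y (J _),
    hV.J_J, reInner_apply y, hV.inner_J_left, hV.J_J, inner_self_eq_norm_sq_to_K]
  congr 1
  simp [← Complex.ofReal_pow]

end IsDiracData

lemma IsEvolution.isEnergyPair (hU : IsEvolution J l V z U) (hV : IsDiracData J l M V) (c : H) :
    IsEnergyPair l M z.im (fun x => ‖U x c‖ ^ 2) (fun x => reInner (J (U x c)) (U x c))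
      (fun x => reInner (U x c) (V x (U x c))) where
  deriv_n := by
    have h := (hU.lipAEDeriv hV).clm ((ContinuousLinearMap.apply ℂ H c).restrictScalars ℝ)
    refine ((h.bilin h reInner).congr fun x _ => (reInner_self _).symm).congr_deriv
      (Eventually.of_forall fun x _ => ?_)
    have := hV.reInner_gen (z := z) x (U x c)
    change reInner (U x c) (gen J V z x (U x c)) + reInner (gen J V z x (U x c)) (U x c) = _
    rw [reInner_comm (gen J V z x (U x c)), this]
    ring
  deriv_s := by
    have h := (hU.lipAEDeriv hV).clm ((ContinuousLinearMap.apply ℂ H c).restrictScalars ℝ)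
    have h' := h.clm (J.restrictScalars ℝ)
    refine (h'.bilin h reInner).congr_deriv (Eventually.of_forall fun x _ => ?_)
    have := hV.reInner_J_gen (z := z) x (U x c)
    change reInner (J (U x c)) (gen J V z x (U x c)) + reInner (J (gen J V z x (U x c))) (U x c) = _
    rw [reInner_apply (J (gen _ _ _ _ _)), hV.inner_J_left, ← reInner_apply,
      reInner_comm (gen J V z x (U x c)), this]
    ring
  abs_p_le x hx := by
    refine (Complex.abs_re_le_norm _).trans ((norm_inner_le_norm _ _).trans ?_)
    calc ‖U x c‖ * ‖V x (U x c)‖ ≤ ‖U x c‖ * (M * ‖U x c‖) :=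
          mul_le_mul_of_nonneg_left ((V x).le_of_opNorm_le (hV.bound x hx) _) (norm_nonneg _)
      _ = _ := by ring
  abs_s_le x := by
    refine (Complex.abs_re_le_norm _).trans ((norm_inner_le_norm _ _).trans ?_)
    rw [hV.norm_J, sq]

lemma IsEvolution.norm_apply_le (hU : IsEvolution J l V z U) (hV : IsDiracData J l M V) {x : ℝ}
    (hx : x ∈ Icc 0 l) (c : H) : ‖U x c‖ ≤ Real.exp (|z.im| * x) * ‖c‖ := by
  have h := (hU.isEnergyPair hV c).n_le hx
  rw [hU.zero (hx.1.trans hx.2), one_apply_eq_self] at h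
  refine (sq_le_sq₀ (norm_nonneg _) (by positivity)).1 (h.trans_eq ?_)
  rw [mul_pow, ← Real.exp_nat_mul]
  push_cast
  ring_nf

lemma IsEvolution.norm_le (hU : IsEvolution J l V z U) (hV : IsDiracData J l M V) {x : ℝ}
    (hx : x ∈ Icc 0 l) : ‖U x‖ ≤ Real.exp (|z.im| * x) :=
  (U x).opNorm_le_bound (Real.exp_nonneg _) (hU.norm_apply_le hV hx)

lemma IsDiracData.norm_add_J_sq (hV : IsDiracData J l M V) (y : H) :
    ‖y + J y‖ ^ 2 = 2 * (‖y‖ ^ 2 + reInner (J y) y) := by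
  have h := hV.norm_J y
  rw [← reInner_self, map_add, map_add, _root_.add_apply, _root_.add_apply, reInner_self,
    reInner_self, h, reInner_comm y (J y)]
  ring

lemma IsDiracData.norm_sub_J_sq (hV : IsDiracData J l M V) (y : H) :
    ‖y - J y‖ ^ 2 = 2 * (‖y‖ ^ 2 - reInner (J y) y) := by
  have h := hV.norm_J y
  rw [← reInner_self, map_sub, map_sub, _root_.sub_apply, _root_.sub_apply, reInner_self,
    reInner_self, h, reInner_comm y (J y)]
  ring

end Energy

section Transfer

open scoped ComplexConjugate InnerProductSpace

variable {H : Type*} [NormedAddCommGroup H] [InnerProductSpace ℂ H] [CompleteSpace H]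
  {J : H →L[ℂ] H} {l M : ℝ} {V V' : ℝ → H →L[ℂ] H} {z w : ℂ} {U U' : ℝ → H →L[ℂ] H}

/-! ### Decaying and growing solutions -/

/-- A solution that is still in the nonnegative cone at the endpoint decays at a rate known up to
`M`. -/
lemma IsEvolution.norm_decaying (hU : IsEvolution J l V z U) (hV : IsDiracData J l M V)
    (hM : 0 ≤ M) (hz : M ≤ z.im) {c : H} (hc : 0 ≤ reInner (J (U l c)) (U l c)) {x : ℝ}
    (hx : x ∈ Icc 0 l) :
    ‖U x c‖ ≤ ‖U x c + J (U x c)‖ ∧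
    ‖U x c + J (U x c)‖ ≤ Real.exp (-((z.im - M) * x)) * ‖c + J c‖ ∧
    ‖c + J c‖ ≤ Real.exp ((z.im + M) * x) * ‖U x c + J (U x c)‖ := by
  have h := hU.isEnergyPair hV c
  have h0 := hU.zero (hx.1.trans hx.2)
  have h1 := h.s_nonneg hz hc hx
  have h2 := h.add_le_of_nonneg hM hz hc hx
  have h3 := h.le_add_of_nonneg hM hz hc hx
  simp only [h0, one_apply_eq_self] at h1 h2 h3
  have e1 := hV.norm_add_J_sq (U x c)
  have e2 := hV.norm_add_J_sq c
  refine ⟨?_, ?_, ?_⟩ <;> refine (sq_le_sq₀ (by positivity) (by positivity)).1 ?_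
  · rw [e1]; nlinarith [sq_nonneg ‖U x c‖]
  · rw [mul_pow, ← Real.exp_nat_mul, e1, e2]
    rw [show ((2 : ℕ) : ℝ) * -((z.im - M) * x) = -(2 * (z.im - M) * x) by push_cast; ring]
    linarith
  · rw [mul_pow, ← Real.exp_nat_mul, e1, e2]
    rw [show ((2 : ℕ) : ℝ) * ((z.im + M) * x) = 2 * (z.im + M) * x by push_cast; ring]
    linarith

/-- A solution with initial value in the eigenspace `J = -1` grows at a rate known up to `M`, and
for large `Im z` its component in the eigenspace `J = 1` is small. -/
lemma IsEvolution.norm_growing (hU : IsEvolution J l V z U) (hV : IsDiracData J l M V)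
    (hM : 0 ≤ M) (hz : 5 * M ≤ z.im) {c : H} (hc : J c = -c) {x : ℝ} (hx : x ∈ Icc 0 l) :
    ‖U x c‖ ≤ ‖U x c - J (U x c)‖ ∧
    3 * ‖U x c + J (U x c)‖ ≤ ‖U x c - J (U x c)‖ ∧
    ‖U x c - J (U x c)‖ ≤ Real.exp ((z.im + M) * x) * (2 * ‖c‖) ∧
    2 * ‖c‖ ≤ Real.exp (-((z.im - M) * x)) * ‖U x c - J (U x c)‖ := by
  have h := hU.isEnergyPair hV c
  have h0 := hU.zero (hx.1.trans hx.2)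
  have hs : reInner (J (U 0 c)) (U 0 c) = -‖U 0 c‖ ^ 2 := by
    rw [h0, one_apply_eq_self, hc, map_neg, _root_.neg_apply, reInner_self]
  have h1 := h.s_le_of_neg hM hz hs hx
  have h2 := h.sub_le_of_neg hM hz hs hx
  have h3 := h.le_sub_of_neg hM hz hs hx
  simp only [h0, one_apply_eq_self] at h1 h2 h3
  have e1 := hV.norm_add_J_sq (U x c)
  have e2 := hV.norm_sub_J_sq (U x c)
  refine ⟨?_, ?_, ?_, ?_⟩ <;> refine (sq_le_sq₀ (by positivity) (by positivity)).1 ?_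
  · rw [e2]; nlinarith [sq_nonneg ‖U x c‖]
  · rw [mul_pow, e1, e2]; linarith
  · rw [mul_pow, ← Real.exp_nat_mul, e2]
    rw [show ((2 : ℕ) : ℝ) * ((z.im + M) * x) = 2 * (z.im + M) * x by push_cast; ring]
    linarith
  · rw [mul_pow, mul_pow, ← Real.exp_nat_mul, e2]
    rw [show ((2 : ℕ) : ℝ) * -((z.im - M) * x) = -(2 * (z.im - M) * x) by push_cast; ring]
    linarith

/-- `Φ` is the operator form of a Weyl function value: it maps the eigenspace `J = 1` to the
eigenspace `J = -1`, and the solutions with initial values `p + Φ p` end in the nonnegative cone. -/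
structure IsWeylOperator (J : H →L[ℂ] H) (l : ℝ) (U : ℝ → H →L[ℂ] H) (Φ : H →L[ℂ] H) : Prop where
  J_apply : ∀ p, J p = p → J (Φ p) = -Φ p
  nonneg : ∀ p, J p = p → 0 ≤ reInner (J (U l (p + Φ p))) (U l (p + Φ p))

/-- Above the threshold, the evolution operators of two potentials are comparable up to the
difference of the Weyl operators, amplified by `exp (2 x Im z)`. The initial value is split into the
initial values of a decaying and of a growing solution. -/
lemma IsEvolution.norm_apply_le_of_weyl (hU : IsEvolution J l V z U) (hV : IsDiracData J l M V)
    (hU' : IsEvolution J l V' z U') (hV' : IsDiracData J l M V') (hM : 0 ≤ M) (hz : 5 * M ≤ z.im)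
    {Φ Φ' : H →L[ℂ] H} (hΦ : IsWeylOperator J l U Φ) (hΦ' : IsWeylOperator J l U' Φ')
    {x : ℝ} (hx : x ∈ Icc 0 l) (c : H) :
    ‖U' x c‖ ≤ Real.exp (2 * M * x) * (10 + 4 * (Real.exp (2 * z.im * x) * ‖Φ - Φ'‖)) *
      ‖U x c‖ := by
  have hz' : M ≤ z.im := by linarith
  set p : H := (2⁻¹ : ℂ) • (c + J c) with hp
  have hJp : J p = p := by rw [hp, map_smul, map_add, hV.J_J, add_comm]
  set f : H := p + Φ p with hf
  set f' : H := p + Φ' p with hf'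
  set h : H := c - f with hh
  set g : H := (Φ - Φ') p with hg
  have hJh : J h = -h := by
    rw [hh, hf, map_sub, map_add, hJp, hΦ.J_apply p hJp]
    have : c + J c = (2 : ℂ) • p := by rw [hp, smul_smul]; norm_num
    rw [eq_sub_of_add_eq' this, two_smul]
    abel
  have hJg : J g = -g := by
    rw [hg, _root_.sub_apply, map_sub, hΦ.J_apply p hJp, hΦ'.J_apply p hJp]; abel
  have hfp : f + J f = (2 : ℂ) • p := by
    rw [hf, map_add, hJp, hΦ.J_apply p hJp, two_smul]; abel
  have hfp' : f' + J f' = (2 : ℂ) • p := by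
    rw [hf', map_add, hJp, hΦ'.J_apply p hJp, two_smul]; abel
  have hc' : c = f' + g + h := by
    rw [hh, hf, hf', hg, _root_.sub_apply]; abel
  have hcf : c = f + h := by rw [hh]; abel
  obtain ⟨-, -, A3⟩ := hU.norm_decaying hV hM hz' (hΦ.nonneg p hJp) hx
  obtain ⟨A1', A2', -⟩ := hU'.norm_decaying hV' hM hz' (hΦ'.nonneg p hJp) hx
  obtain ⟨-, B2, -, B4⟩ := hU.norm_growing hV hM hz hJh hx
  obtain ⟨B1', -, B3', -⟩ := hU'.norm_growing hV' hM hz hJh hx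
  obtain ⟨C1', -, C3', -⟩ := hU'.norm_growing hV' hM hz hJg hx
  rw [← hf] at A3
  rw [← hf'] at A1' A2'
  rw [hfp, norm_smul, Complex.norm_ofNat] at A3
  rw [hfp', norm_smul, Complex.norm_ofNat] at A2'
  set a := ‖U x f + J (U x f)‖ with ha
  set b := ‖U x h - J (U x h)‖ with hb
  have hUc : U x c = U x f + U x h := by rw [hcf, map_add]
  -- The two components of `U x c` control both solutions.
  -- The growing one is nearly in the eigenspace `J = -1`, which makes the estimates solvable.
  have hplus : a ≤ 2 * ‖U x c‖ + ‖U x h + J (U x h)‖ := by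
    have e : U x f + J (U x f) = (U x c + J (U x c)) - (U x h + J (U x h)) := by
      rw [hUc, map_add J (U x f) (U x h)]; abel
    rw [ha, e]
    refine (norm_sub_le _ _).trans (add_le_add_left ((norm_add_le _ _).trans ?_) _)
    rw [hV.norm_J]; linarith
  have hminus : b ≤ 2 * ‖U x c‖ + a := by
    have e : U x h - J (U x h) = (U x c - J (U x c)) - (U x f - J (U x f)) := by
      rw [hUc, map_add J (U x f) (U x h)]; abel
    have e2 : ‖U x f - J (U x f)‖ ≤ a := by
      refine (sq_le_sq₀ (norm_nonneg _) (norm_nonneg _)).1 ?_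
      rw [hV.norm_add_J_sq, hV.norm_sub_J_sq]
      have := (hU.isEnergyPair hV f).s_nonneg hz' (hΦ.nonneg p hJp) hx
      linarith
    rw [hb, e]
    refine (norm_sub_le _ _).trans (add_le_add ((norm_sub_le _ _).trans ?_) e2)
    rw [hV.norm_J]; linarith
  have ha4 : a ≤ 4 * ‖U x c‖ := by linarith
  have hb6 : b ≤ 6 * ‖U x c‖ := by linarith
  have E1 : Real.exp (-((z.im - M) * x)) * Real.exp ((z.im + M) * x) = Real.exp (2 * M * x) := by
    rw [← Real.exp_add]; ring_nf
  have E2 : Real.exp ((z.im + M) * x) * Real.exp ((z.im + M) * x) =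
      Real.exp (2 * M * x) * Real.exp (2 * z.im * x) := by
    rw [← Real.exp_add, ← Real.exp_add]; ring_nf
  -- Each solution of the second system is compared with the first through the common initial value.
  have F : ‖U' x f'‖ ≤ Real.exp (2 * M * x) * a := by
    calc _ ≤ Real.exp (-((z.im - M) * x)) * (2 * ‖p‖) := A1'.trans A2'
      _ ≤ Real.exp (-((z.im - M) * x)) * (Real.exp ((z.im + M) * x) * a) := by gcongr
      _ = _ := by rw [← mul_assoc, E1]
  have K : ‖U' x h‖ ≤ Real.exp (2 * M * x) * b := by
    calc _ ≤ Real.exp ((z.im + M) * x) * (2 * ‖h‖) := B1'.trans B3'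
      _ ≤ Real.exp ((z.im + M) * x) * (Real.exp (-((z.im - M) * x)) * b) := by gcongr
      _ = _ := by rw [← mul_assoc, mul_comm (Real.exp ((z.im + M) * x)), E1]
  have G : ‖U' x g‖ ≤ Real.exp (2 * M * x) * (Real.exp (2 * z.im * x) * ‖Φ - Φ'‖) * a := by
    calc _ ≤ Real.exp ((z.im + M) * x) * (2 * ‖g‖) := C1'.trans C3'
      _ ≤ Real.exp ((z.im + M) * x) * (2 * (‖Φ - Φ'‖ * ‖p‖)) := by
        gcongr; exact (Φ - Φ').le_opNorm p
      _ = Real.exp ((z.im + M) * x) * ‖Φ - Φ'‖ * (2 * ‖p‖) := by ring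
      _ ≤ Real.exp ((z.im + M) * x) * ‖Φ - Φ'‖ * (Real.exp ((z.im + M) * x) * a) := by gcongr
      _ = (Real.exp ((z.im + M) * x) * Real.exp ((z.im + M) * x)) * ‖Φ - Φ'‖ * a := by ring
      _ = _ := by rw [E2]; ring
  have hsum : ‖U' x c‖ ≤ ‖U' x f'‖ + ‖U' x g‖ + ‖U' x h‖ := by
    rw [hc', map_add, map_add]; exact norm_add₃_le
  calc _ ≤ _ := hsum
    _ ≤ Real.exp (2 * M * x) * a +
        Real.exp (2 * M * x) * (Real.exp (2 * z.im * x) * ‖Φ - Φ'‖) * a +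
        Real.exp (2 * M * x) * b := by gcongr
    _ ≤ Real.exp (2 * M * x) * (4 * ‖U x c‖) +
        Real.exp (2 * M * x) * (Real.exp (2 * z.im * x) * ‖Φ - Φ'‖) * (4 * ‖U x c‖) +
        Real.exp (2 * M * x) * (6 * ‖U x c‖) := by gcongr
    _ = _ := by ring

/-! ### Analyticity in the spectral parameter -/

/-- A family of evolution operators over all spectral parameters is entire in the parameter. -/
lemma differentiable_evolution [FiniteDimensional ℂ H] (hV : IsDiracData J l M V)
    {W : ℝ → ℂ → H →L[ℂ] H} (hW : ∀ z, IsEvolution J l V z fun x => W x z) {x : ℝ}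
    (hx : x ∈ Icc 0 l) : Differentiable ℂ (W x) := by
  intro z
  -- `W t w = W t z * P t w` with `P` given by the Lagrange identity.
  have key : ∀ w, ∀ t ∈ Icc (0 : ℝ) l, W t w = W t z * (1 + (Complex.I * (w - z)) •
      ∫ r in (0 : ℝ)..t, star (W r (conj z)) * J * W r w) := by
    intro w t ht
    rw [← (hW (conj z)).star_mul hV (hW w) ht, ← mul_assoc,
      (hW (conj z)).mul_star_self hV (hW z) ht, one_mul]
  have hbd : ∀ᶠ w in 𝓝 z, ∀ t ∈ Icc (0 : ℝ) l, ‖star (W t (conj z)) * J * W t w‖ ≤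
      Real.exp (|z.im| * l) * ‖J‖ * Real.exp ((|z.im| + 1) * l) := by
    have : ∀ᶠ w in 𝓝 z, |w.im| < |z.im| + 1 :=
      (Complex.continuous_im.abs.tendsto z).eventually (gt_mem_nhds (by simp))
    filter_upwards [this] with w hw t ht
    have hl : 0 ≤ l := ht.1.trans ht.2
    have h1 : ‖star (W t (conj z))‖ ≤ Real.exp (|z.im| * l) := by
      rw [norm_star]
      refine ((hW (conj z)).norm_le hV ht).trans (Real.exp_le_exp.2 ?_)
      rw [Complex.conj_im, abs_neg]
      exact mul_le_mul_of_nonneg_left ht.2 (abs_nonneg _)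
    have h2 : ‖W t w‖ ≤ Real.exp ((|z.im| + 1) * l) := by
      refine ((hW w).norm_le hV ht).trans (Real.exp_le_exp.2 ?_)
      exact mul_le_mul hw.le ht.2 ht.1 (by positivity)
    calc _ ≤ ‖star (W t (conj z))‖ * ‖J‖ * ‖W t w‖ :=
          (norm_mul_le _ _).trans (mul_le_mul_of_nonneg_right (norm_mul_le _ _) (norm_nonneg _))
      _ ≤ _ := by gcongr
  have hcont : ∀ t ∈ Icc (0 : ℝ) l, ContinuousAt (W t) z := by
    intro t ht
    have hsm : Tendsto (fun w => (Complex.I * (w - z)) •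
        ∫ r in (0 : ℝ)..t, star (W r (conj z)) * J * W r w) (𝓝 z) (𝓝 0) := by
      have h0 : Tendsto (fun w => Complex.I * (w - z)) (𝓝 z) (𝓝 0) := by
        have : Continuous fun w => Complex.I * (w - z) := by fun_prop
        simpa using this.tendsto z
      refine h0.zero_smul_isBoundedUnder_le ?_
      refine isBoundedUnder_of_eventually_le
        (a := Real.exp (|z.im| * l) * ‖J‖ * Real.exp ((|z.im| + 1) * l) * |t - 0|) ?_
      filter_upwards [hbd] with w hw
      refine intervalIntegral.norm_integral_le_of_norm_le_const fun r hr => hw r ?_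
      rw [uIoc_of_le ht.1] at hr
      exact ⟨hr.1.le, hr.2.trans ht.2⟩
    have h1 := (tendsto_const_nhds (x := W t z)).mul ((tendsto_const_nhds
      (x := (1 : H →L[ℂ] H))).add hsm)
    simp only [add_zero, mul_one] at h1
    refine h1.congr fun w => (key w t ht).symm
  have hint : ContinuousAt (fun w => ∫ r in (0 : ℝ)..x, star (W r (conj z)) * J * W r w) z := by
    have hsub : ∀ r ∈ uIoc (0 : ℝ) x, r ∈ Icc (0 : ℝ) l := by
      intro r hr
      rw [uIoc_of_le hx.1] at hr
      exact ⟨hr.1.le, hr.2.trans hx.2⟩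
    refine intervalIntegral.continuousAt_of_dominated_interval
      (bound := fun _ => Real.exp (|z.im| * l) * ‖J‖ * Real.exp ((|z.im| + 1) * l)) ?_ ?_ ?_ ?_
    · refine Eventually.of_forall fun w => ?_
      refine ContinuousOn.aestronglyMeasurable (fun r hr => ?_) measurableSet_uIoc
      exact ((((hW (conj z)).continuousOn.star.mul continuousOn_const).mul
        (hW w).continuousOn).mono hsub) r hr
    · filter_upwards [hbd] with w hw
      exact Eventually.of_forall fun r hr => hw r (hsub r hr)
    · exact intervalIntegrable_const
    · exact Eventually.of_forall fun r hr => continuousAt_const.mul (hcont r (hsub r hr))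
  have hW' : W x = fun w => W x z * (1 + (Complex.I * (w - z)) •
      ∫ r in (0 : ℝ)..x, star (W r (conj z)) * J * W r w) := funext fun w => key w x hx
  rw [hW']
  refine (differentiableAt_const _).mul ((differentiableAt_const _).add ?_)
  -- The prefactor vanishes at `z`, so continuity of the integral at `z` is enough.
  refine (hasDerivAt_iff_tendsto_slope (f' := Complex.I •
    ∫ r in (0 : ℝ)..x, star (W r (conj z)) * J * W r z)).2 ?_ |>.differentiableAt
  refine Tendsto.congr' ?_ ((hint.const_smul Complex.I).tendsto.mono_left nhdsWithin_le_nhds)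
  filter_upwards [self_mem_nhdsWithin] with w hw
  have hw' : w - z ≠ 0 := sub_ne_zero.2 hw
  rw [slope_def_module]
  simp only [sub_self, mul_zero, zero_smul, sub_zero, smul_smul]
  field_simp
  rfl

end Transfer

/-! ### Entire functions of exponential type bounded on four rays -/

section PhragmenLindelof

open scoped ComplexConjugate

variable {E : Type*} [NormedAddCommGroup E] [NormedSpace ℂ E]

/-- The Phragmén–Lindelöf principle for a function of exponential type in a sector of opening less
than `π`, in logarithmic coordinates. -/
lemma norm_comp_exp_le_of_strip {f : ℂ → E} (hf : Differentiable ℂ f) {B : ℝ}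
    (hB : ∀ z, ‖f z‖ ≤ Real.exp (B * ‖z‖)) {a b C : ℝ} (hab : a < b) (hab' : b - a < Real.pi)
    (ha : ∀ z : ℂ, z.im = a → ‖f (Complex.exp z)‖ ≤ C)
    (hb : ∀ z : ℂ, z.im = b → ‖f (Complex.exp z)‖ ≤ C) {z : ℂ} (hza : a ≤ z.im) (hzb : z.im ≤ b) :
    ‖f (Complex.exp z)‖ ≤ C := by
  refine PhragmenLindelof.horizontal_strip (f := fun z => f (Complex.exp z)) (a := a) (b := b)
    (hf.comp Complex.differentiable_exp).diffContOnCl ?_ ha hb hza hzb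
  refine ⟨1, (one_lt_div (by linarith)).2 hab', |B|, ?_⟩
  refine IsBigO.of_bound 1 (Eventually.of_forall fun w => ?_)
  rw [one_mul, Real.norm_eq_abs, Real.abs_exp, one_mul]
  refine (hB _).trans (Real.exp_le_exp.2 ?_)
  rw [Complex.norm_exp]
  exact mul_le_mul (le_abs_self _) (Real.exp_le_exp.2 (le_abs_self _)) (Real.exp_nonneg _)
    (abs_nonneg _)

/-- An entire function of exponential type which is bounded on the real line, on a ray in the upper
half-plane and on the conjugate ray is constant. -/
lemma apply_eq_apply_of_bounded_on_rays {f : ℂ → E} (hf : Differentiable ℂ f) {B C c : ℝ}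
    (hB : ∀ z, ‖f z‖ ≤ Real.exp (B * ‖z‖)) (hreal : ∀ t : ℝ, ‖f t‖ ≤ C)
    (hray : ∀ z : ℂ, 0 < z.im → z.re = c * z.im → ‖f z‖ ≤ C ∧ ‖f (conj z)‖ ≤ C) (z w : ℂ) :
    f z = f w := by
  refine hf.apply_eq_apply_of_bounded (isBounded_iff_forall_norm_le.2 ⟨C, ?_⟩) z w
  rintro _ ⟨z, rfl⟩
  -- The rays `arg z = ± α` and the real line bound four sectors of opening less than `π`.
  set ζ : ℂ := ⟨c, 1⟩ with hζ
  have hζ0 : ζ ≠ 0 := fun h => by simpa [hζ] using congr(Complex.im $h)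
  set α := ζ.arg with hα
  have hα0 : 0 < α := by
    refine lt_of_le_of_ne (Complex.arg_nonneg_iff.2 (by simp [hζ])) fun h => ?_
    have := (Complex.arg_eq_zero_iff.1 h.symm).2
    simp [hζ] at this
  have hαpi : α < Real.pi := by
    refine lt_of_le_of_ne (Complex.arg_le_pi _) fun h => ?_
    have := (Complex.arg_eq_pi_iff.1 h).2
    simp [hζ] at this
  have hup : ∀ z : ℂ, z.im = α → ‖f (Complex.exp z)‖ ≤ C ∧ ‖f (conj (Complex.exp z))‖ ≤ C := by
    intro z hz
    have h1 : Complex.exp z = (Real.exp z.re / ‖ζ‖ : ℝ) * ζ := by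
      have h2 : (‖ζ‖ : ℂ) ≠ 0 := by simpa using hζ0
      have h3 : ‖ζ‖ * Complex.exp (α * Complex.I) = ζ := Complex.norm_mul_exp_arg_mul_I ζ
      have h4 : Complex.exp z = Complex.exp z.re * Complex.exp (α * Complex.I) := by
        rw [← Complex.exp_add, ← hz, Complex.re_add_im]
      rw [h4, Complex.ofReal_div, Complex.ofReal_exp, div_mul_eq_mul_div, eq_div_iff h2,
        mul_assoc, mul_comm (Complex.exp (α * Complex.I)), h3]
    have hpos : 0 < Real.exp z.re / ‖ζ‖ := div_pos (Real.exp_pos _) (norm_pos_iff.2 hζ0)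
    rw [h1]
    refine hray _ ?_ ?_
    · rw [Complex.im_ofReal_mul]; simpa [hζ] using hpos
    · rw [Complex.im_ofReal_mul, Complex.re_ofReal_mul]; simp [hζ, mul_comm]
  have hdown : ∀ z : ℂ, z.im = -α → ‖f (Complex.exp z)‖ ≤ C := by
    intro z hz
    have := (hup (conj z) (by simp [hz])).2
    rwa [Complex.exp_conj, Complex.conj_conj] at this
  have hzero : ∀ z : ℂ, z.im = 0 → ‖f (Complex.exp z)‖ ≤ C := by
    intro z hz
    have := hreal (Real.exp z.re)
    rwa [Complex.ofReal_exp, show (z.re : ℂ) = z from Complex.ext rfl (by simp [hz])] at this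
  have hpi : ∀ z : ℂ, z.im = Real.pi ∨ z.im = -Real.pi → ‖f (Complex.exp z)‖ ≤ C := by
    intro z hz
    have h1 : Complex.exp z = ((-Real.exp z.re : ℝ) : ℂ) := by
      rw [Complex.exp_eq_exp_re_mul_sin_add_cos]
      rcases hz with hz | hz <;> simp [hz]
    rw [h1]
    exact hreal _
  rcases eq_or_ne z 0 with rfl | hz
  · simpa using hreal 0
  rw [← Complex.exp_log hz]
  have him : (Complex.log z).im = z.arg := Complex.log_im z
  have h1 := Complex.neg_pi_lt_arg z
  have h2 := Complex.arg_le_pi z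
  rcases le_total (Complex.log z).im 0 with h0 | h0
  · rcases le_total (Complex.log z).im (-α) with h3 | h3
    · exact norm_comp_exp_le_of_strip hf hB (by linarith) (by linarith)
        (fun z hz => hpi z (Or.inr hz)) hdown (by linarith) h3
    · exact norm_comp_exp_le_of_strip hf hB (by linarith) (by linarith) hdown hzero h3 h0
  · rcases le_total (Complex.log z).im α with h3 | h3
    · exact norm_comp_exp_le_of_strip hf hB (by linarith) (by linarith) hzero
        (fun z hz => (hup z hz).1) h0 h3
    · exact norm_comp_exp_le_of_strip hf hB (by linarith) (by linarith)
        (fun z hz => (hup z hz).1) (fun z hz => hpi z (Or.inl hz)) h3 (by linarith)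

end PhragmenLindelof

/-! ### Uniqueness of the potential -/

section Uniqueness

open scoped ComplexConjugate

variable {H : Type*} [NormedAddCommGroup H] [InnerProductSpace ℂ H] [CompleteSpace H]
  {J : H →L[ℂ] H} {l M : ℝ} {V V' : ℝ → H →L[ℂ] H}
  {W W' : ℝ → ℂ → H →L[ℂ] H} {Φ Φ' : ℂ → H →L[ℂ] H}

/-- The transfer operator `W' W⁻¹` between two systems; the inverse is written through the adjoint
at the conjugate spectral parameter. -/
noncomputable def transfer (W W' : ℝ → ℂ → H →L[ℂ] H) (x : ℝ) (z : ℂ) : H →L[ℂ] H :=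
  W' x z * star (W x (conj z))

lemma star_transfer (x : ℝ) (z : ℂ) : star (transfer W W' x z) = transfer W' W x (conj z) := by
  simp [transfer]

lemma norm_transfer_le (hV : IsDiracData J l M V) (hV' : IsDiracData J l M V')
    (hW : ∀ z, IsEvolution J l V z fun x => W x z)
    (hW' : ∀ z, IsEvolution J l V' z fun x => W' x z) {x : ℝ} (hx : x ∈ Icc 0 l) (z : ℂ) :
    ‖transfer W W' x z‖ ≤ Real.exp (2 * x * |z.im|) := by
  refine (norm_mul_le _ _).trans ?_
  rw [norm_star]
  have h1 := (hW' z).norm_le hV' hx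
  have h2 := (hW (conj z)).norm_le hV hx
  rw [Complex.conj_im, abs_neg] at h2
  calc _ ≤ Real.exp (|z.im| * x) * Real.exp (|z.im| * x) := by gcongr
    _ = _ := by rw [← Real.exp_add]; ring_nf

lemma lipAEDeriv_transfer (hV : IsDiracData J l M V) (hV' : IsDiracData J l M V')
    (hW : ∀ z, IsEvolution J l V z fun x => W x z)
    (hW' : ∀ z, IsEvolution J l V' z fun x => W' x z) (z : ℂ) :
    LipAEDeriv l (fun x => transfer W W' x z)
      (fun x => gen J V' z x * transfer W W' x z - transfer W W' x z * gen J V z x) := by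
  refine (((hW' z).lipAEDeriv hV').mul ((hW (conj z)).lipAEDeriv_star hV)).congr_deriv
    (Eventually.of_forall fun x _ => ?_)
  rw [Complex.conj_conj, transfer]
  noncomm_ring

/-- If the transfer operator does not depend on the spectral parameter, the potentials agree:
comparing two parameters shows that it commutes with `J`, and then its `J`-commuting part has
derivative zero. -/
lemma potential_eq_of_transfer_eq (hV : IsDiracData J l M V) (hV' : IsDiracData J l M V')
    (hW : ∀ z, IsEvolution J l V z fun x => W x z)
    (hW' : ∀ z, IsEvolution J l V' z fun x => W' x z) {r : ℝ} (hr : 0 < r) (hrl : r ≤ l)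
    (h : ∀ x ∈ Ioo 0 r, transfer W W' x 0 = transfer W W' x 1) :
    ∀ᵐ x : ℝ, x ∈ Ioo 0 r → V x = V' x := by
  have d0 := (lipAEDeriv_transfer hV hV' hW hW' 0).mono hrl
  have d1 := (lipAEDeriv_transfer hV hV' hW hW' 1).mono hrl
  set T : ℝ → H →L[ℂ] H := fun x => transfer W W' x 0 with hT
  have hJJ := hV.J_mul_J
  -- The derivatives at the parameters `0` and `1` differ by `i (J T - T J)`.
  have hcomm : ∀ᵐ x : ℝ, x ∈ Ioo 0 r → J * T x = T x * J := by
    filter_upwards [d0.deriv, d1.deriv] with x h0 h1 hx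
    have e : (fun x => transfer W W' x 1) =ᶠ[𝓝 x] T := by
      filter_upwards [Ioo_mem_nhds hx.1 hx.2] with y hy using (h y hy).symm
    have h2 := (h0 hx).unique ((h1 hx).congr_of_eventuallyEq e.symm)
    rw [← h x hx, ← sub_eq_zero] at h2
    have h3 : Complex.I • (J * T x - T x * J) = 0 := by
      rw [← neg_eq_zero, ← h2]
      simp only [gen, hT, mul_zero, mul_one, zero_smul, zero_add, add_mul, mul_add,
        smul_mul_assoc, mul_smul_comm, smul_sub]
      abel
    exact sub_eq_zero.1 ((smul_eq_zero.1 h3).resolve_left Complex.I_ne_zero)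
  have hT0 : T 0 = 1 := by
    simp [hT, transfer, (hW _).zero (hr.le.trans hrl), (hW' _).zero (hr.le.trans hrl)]
  have cJ : LipAEDeriv r (fun _ : ℝ => J) (fun _ => 0) :=
    ⟨⟨0, (LipschitzWith.const _).lipschitzOnWith⟩,
      Eventually.of_forall fun x _ => hasDerivAt_const _ _⟩
  -- `T' = J V' T - T J V` anticommutes with `J`, so it cancels in the derivative of `T + J T J`.
  have hS := (d0.add ((cJ.mul d0).mul cJ)).congr_deriv (g' := fun _ => 0) (by
    filter_upwards [hcomm] with x hc hx
    have hc := hc hx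
    change gen J V' 0 x * T x - T x * gen J V 0 x + (J * T x * 0 +
      (J * (gen J V' 0 x * T x - T x * gen J V 0 x) + 0 * T x) * J) = 0
    have g0 : ∀ V : ℝ → H →L[ℂ] H, gen J V 0 x = J * V x := fun V => by simp [gen]
    rw [g0, g0]
    have a1 : J * (J * V' x * T x) * J = -(J * V' x * T x) := by
      calc _ = J * J * V' x * (T x * J) := by noncomm_ring
        _ = V' x * J * T x := by rw [hJJ, ← hc]; noncomm_ring
        _ = _ := by rw [hV'.anti]; noncomm_ring
    have a2 : J * (T x * (J * V x)) * J = -(T x * (J * V x)) := by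
      calc _ = (J * T x) * J * (V x * J) := by noncomm_ring
        _ = T x * (J * J) * (V x * J) := by rw [hc]; noncomm_ring
        _ = _ := by rw [hJJ, hV.anti]; noncomm_ring
    rw [mul_sub, mul_zero, zero_mul, zero_add, add_zero, sub_mul, a1, a2]
    abel)
  have hT1 : EqOn T (fun _ => 1) (Ioo 0 r) := by
    refine Measure.eqOn_open_of_ae_eq (μ := volume) ?_ isOpen_Ioo
      (d0.continuousOn.mono Ioo_subset_Icc_self) continuousOn_const
    rw [EventuallyEq, ae_restrict_iff' measurableSet_Ioo]
    filter_upwards [hcomm] with x hc hx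
    have h1 := hS.eq_of_deriv_eq_zero (Ioo_subset_Icc_self hx)
    change T x + J * T x * J = T 0 + J * T 0 * J at h1
    rw [hc hx, mul_assoc, hJJ, hT0, mul_one, mul_one, hJJ, ← two_smul ℂ, ← two_smul ℂ] at h1
    exact smul_right_injective _ (two_ne_zero' ℂ) h1
  filter_upwards [d0.deriv] with x h0 hx
  have e : T =ᶠ[𝓝 x] fun _ => 1 := by
    filter_upwards [Ioo_mem_nhds hx.1 hx.2] with y hy using hT1 hy
  have h1 := (h0 hx).unique ((hasDerivAt_const x (1 : H →L[ℂ] H)).congr_of_eventuallyEq e)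
  have h2 : transfer W W' x 0 = 1 := hT1 hx
  rw [h2, mul_one, one_mul, sub_eq_zero] at h1
  have h3 : J * V' x = J * V x := by simpa [gen] using h1
  calc V x = J * (J * V x) := by rw [← mul_assoc, hJJ, one_mul]
    _ = J * (J * V' x) := by rw [h3]
    _ = V' x := by rw [← mul_assoc, hJJ, one_mul]

variable [FiniteDimensional ℂ H]

lemma differentiable_transfer (hV : IsDiracData J l M V) (hV' : IsDiracData J l M V')
    (hW : ∀ z, IsEvolution J l V z fun x => W x z)
    (hW' : ∀ z, IsEvolution J l V' z fun x => W' x z) {x : ℝ} (hx : x ∈ Icc 0 l) :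
    Differentiable ℂ (transfer W W' x) := by
  intro z
  refine (differentiable_evolution hV' hW' hx z).mul ?_
  have h := (differentiable_evolution hV hW hx (conj z)).star_star
  simpa [Function.comp_def] using h

/-- If the Weyl operators agree along a ray up to `exp (-2 x Im z)`, the transfer operator at `x`
is bounded on that ray. -/
lemma exists_norm_transfer_le_on_ray (hM : 0 < M)
    (hV : IsDiracData J l M V) (hV' : IsDiracData J l M V')
    (hW : ∀ z, IsEvolution J l V z fun x => W x z)
    (hW' : ∀ z, IsEvolution J l V' z fun x => W' x z)
    (hΦ : ∀ z ∈ halfPlane M, IsWeylOperator J l (fun x => W x z) (Φ z))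
    (hΦ' : ∀ z ∈ halfPlane M, IsWeylOperator J l (fun x => W' x z) (Φ' z))
    {x c : ℝ} (hx : x ∈ Icc 0 l)
    (h : (fun z => Φ z - Φ' z) =O[rayAtInfty c]
      (fun z : ℂ => Complex.exp (2 * Complex.I * x * z))) :
    ∃ C, ∀ z : ℂ, 0 < z.im → z.re = c * z.im → ‖transfer W W' x z‖ ≤ C := by
  obtain ⟨K, hK⟩ := h.bound
  rw [rayAtInfty, eventually_inf_principal, eventually_comap] at hK
  obtain ⟨Y, hY⟩ := eventually_atTop.1 hK
  -- Only a bounded part of the ray lies below the height from which the comparison is available.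
  refine ⟨max (Real.exp (2 * M * x) * (10 + 4 * |K|)) (Real.exp (2 * x * max Y (5 * M))),
    fun z hz hzc => ?_⟩
  rcases le_total (max Y (5 * M)) z.im with hl | hl
  · -- The comparison at the initial value `W⁻¹ d` is the bound for the transfer operator at `d`.
    refine le_max_of_le_left (ContinuousLinearMap.opNorm_le_bound _ (by positivity) fun d => ?_)
    have hzM : z ∈ halfPlane M := by
      have := (le_max_right Y (5 * M)).trans hl
      change M < z.im
      linarith
    have h1 := (hW z).norm_apply_le_of_weyl hV (hW' z) hV' hM.le ((le_max_right _ _).trans hl)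
      (hΦ z hzM) (hΦ' z hzM) hx (star (W x (conj z)) d)
    have h2 : W x z (star (W x (conj z)) d) = d :=
      congr($((hW (conj z)).mul_star_self hV (hW z) hx) d)
    rw [h2] at h1
    refine h1.trans (mul_le_mul_of_nonneg_right ?_ (norm_nonneg _))
    refine mul_le_mul_of_nonneg_left ?_ (Real.exp_nonneg _)
    have h3 := hY z.im ((le_max_left _ _).trans hl) z rfl hzc
    rw [Complex.norm_exp] at h3
    have h4 : (2 * Complex.I * x * z).re = -(2 * z.im * x) := by simp; ring
    rw [h4, Real.exp_neg] at h3
    have h5 : Real.exp (2 * z.im * x) * ‖Φ z - Φ' z‖ ≤ |K| := by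
      refine le_trans ?_ (le_abs_self K)
      rwa [← div_eq_mul_inv, le_div_iff₀' (Real.exp_pos _)] at h3
    linarith
  · refine le_max_of_le_right ((norm_transfer_le hV hV' hW hW' hx z).trans ?_)
    rw [abs_of_pos hz]
    exact Real.exp_le_exp.2 (mul_le_mul_of_nonneg_left hl (by linarith [hx.1]))

/-- Exponentially close Weyl operators force the transfer operator to be independent of the spectral
parameter. -/
lemma transfer_eq_transfer (hM : 0 < M)
    (hV : IsDiracData J l M V) (hV' : IsDiracData J l M V')
    (hW : ∀ z, IsEvolution J l V z fun x => W x z)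
    (hW' : ∀ z, IsEvolution J l V' z fun x => W' x z)
    (hΦ : ∀ z ∈ halfPlane M, IsWeylOperator J l (fun x => W x z) (Φ z))
    (hΦ' : ∀ z ∈ halfPlane M, IsWeylOperator J l (fun x => W' x z) (Φ' z))
    {x c : ℝ} (hx : x ∈ Icc 0 l)
    (h : (fun z => Φ z - Φ' z) =O[rayAtInfty c]
      (fun z : ℂ => Complex.exp (2 * Complex.I * x * z))) (z w : ℂ) :
    transfer W W' x z = transfer W W' x w := by
  obtain ⟨C₁, h₁⟩ := exists_norm_transfer_le_on_ray hM hV hV' hW hW' hΦ hΦ' hx h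
  obtain ⟨C₂, h₂⟩ := exists_norm_transfer_le_on_ray hM hV' hV hW' hW hΦ' hΦ hx
    (by simpa using h.neg_left)
  refine apply_eq_apply_of_bounded_on_rays (differentiable_transfer hV hV' hW hW' hx) (B := 2 * x)
    (C := max 1 (max C₁ C₂)) (c := c) ?_ ?_ ?_ z w
  · refine fun z => (norm_transfer_le hV hV' hW hW' hx z).trans (Real.exp_le_exp.2 ?_)
    exact mul_le_mul_of_nonneg_left (Complex.abs_im_le_norm z) (by linarith [hx.1])
  · intro t
    refine (norm_transfer_le hV hV' hW hW' hx t).trans ?_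
    simp
  · intro z hz hzc
    refine ⟨(h₁ z hz hzc).trans (by simp), ?_⟩
    rw [← star_transfer, norm_star]
    exact (h₂ z hz hzc).trans (by simp)

/-- The local uniqueness theorem in operator form. -/
theorem potential_eq_of_weyl (hM : 0 < M)
    (hV : IsDiracData J l M V) (hV' : IsDiracData J l M V')
    (hW : ∀ z, IsEvolution J l V z fun x => W x z)
    (hW' : ∀ z, IsEvolution J l V' z fun x => W' x z)
    (hΦ : ∀ z ∈ halfPlane M, IsWeylOperator J l (fun x => W x z) (Φ z))
    (hΦ' : ∀ z ∈ halfPlane M, IsWeylOperator J l (fun x => W' x z) (Φ' z))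
    {r c : ℝ} (hr : 0 < r) (hrl : r ≤ l)
    (h : ∀ x : ℝ, 0 < x → x < r → (fun z => Φ z - Φ' z) =O[rayAtInfty c]
      (fun z : ℂ => Complex.exp (2 * Complex.I * x * z))) :
    ∀ᵐ x : ℝ, x ∈ Ioo 0 r → V x = V' x :=
  potential_eq_of_transfer_eq hV hV' hW hW' hr hrl fun x hx =>
    transfer_eq_transfer hM hV hV' hW hW' hΦ hΦ' ⟨hx.1.le, hx.2.le.trans hrl⟩
      (h x hx.1 hx.2) 0 1

end Uniqueness

/-! ### From matrices to operators -/

section Matrices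

open scoped ComplexConjugate InnerProductSpace
open WithLp

variable {m₁ m₂ : ℕ} {l M : ℝ} {v : ℝ → Matrix (Fin m₁) (Fin m₂) ℂ} {z : ℂ}

/-- A square block matrix as an operator on Euclidean space. -/
noncomputable abbrev toOp (m₁ m₂ : ℕ) :
    Matrix (Fin m₁ ⊕ Fin m₂) (Fin m₁ ⊕ Fin m₂) ℂ ≃⋆ₐ[ℂ]
      (EuclideanSpace ℂ (Fin m₁ ⊕ Fin m₂) →L[ℂ] EuclideanSpace ℂ (Fin m₁ ⊕ Fin m₂)) :=
  Matrix.toEuclideanCLM (n := Fin m₁ ⊕ Fin m₂) (𝕜 := ℂ)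

/-- `toOp` as a real linear isometry; the norm on matrices is defined by this identification. -/
noncomputable def toOpIsometry (m₁ m₂ : ℕ) :
    Matrix (Fin m₁ ⊕ Fin m₂) (Fin m₁ ⊕ Fin m₂) ℂ →ₗᵢ[ℝ]
      (EuclideanSpace ℂ (Fin m₁ ⊕ Fin m₂) →L[ℂ] EuclideanSpace ℂ (Fin m₁ ⊕ Fin m₂)) where
  toFun := toOp m₁ m₂
  map_add' := map_add _
  map_smul' c A := by
    rw [RingHom.id_apply, ← Complex.coe_smul]
    exact map_smul (toOp m₁ m₂) (c : ℂ) A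
  norm_map' _ := rfl

lemma toOpIsometry_apply (A : Matrix (Fin m₁ ⊕ Fin m₂) (Fin m₁ ⊕ Fin m₂) ℂ) :
    toOpIsometry m₁ m₂ A = toOp m₁ m₂ A := rfl

lemma norm_VMat_le (A : Matrix (Fin m₁) (Fin m₂) ℂ) : ‖VMat A‖ ≤ ‖A‖ := by
  rw [Matrix.cstar_norm_def]
  refine ContinuousLinearMap.opNorm_le_bound _ (norm_nonneg _) fun x => ?_
  set a : EuclideanSpace ℂ (Fin m₁) := toLp 2 fun i => x (Sum.inl i) with ha
  set b : EuclideanSpace ℂ (Fin m₂) := toLp 2 fun i => x (Sum.inr i) with hb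
  have h1 : ‖x‖ ^ 2 = ‖a‖ ^ 2 + ‖b‖ ^ 2 := by
    simp [EuclideanSpace.norm_sq_eq, ha, hb]
  have h2 : ‖toOp m₁ m₂ (VMat A) x‖ ^ 2 = ‖(toLp 2 (A *ᵥ ofLp b) : EuclideanSpace ℂ (Fin m₁))‖ ^ 2 +
      ‖(toLp 2 (Aᴴ *ᵥ ofLp a) : EuclideanSpace ℂ (Fin m₂))‖ ^ 2 := by
    have hx : ofLp x = Sum.elim (ofLp a) (ofLp b) := by
      ext i; rcases i with i | i <;> rfl
    simp [EuclideanSpace.norm_sq_eq, VMat, hx, Matrix.fromBlocks_mulVec]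
  have h3 : ‖(toLp 2 (A *ᵥ ofLp b) : EuclideanSpace ℂ (Fin m₁))‖ ≤ ‖A‖ * ‖b‖ :=
    A.l2_opNorm_mulVec b
  have h4 : ‖(toLp 2 (Aᴴ *ᵥ ofLp a) : EuclideanSpace ℂ (Fin m₂))‖ ≤ ‖A‖ * ‖a‖ := by
    rw [← Matrix.l2_opNorm_conjTranspose A]; exact Aᴴ.l2_opNorm_mulVec a
  refine (sq_le_sq₀ (norm_nonneg _) (by positivity)).1 ?_
  rw [h2, mul_pow, h1]
  nlinarith [pow_le_pow_left₀ (norm_nonneg _) h3 2, pow_le_pow_left₀ (norm_nonneg _) h4 2]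

lemma IsBoundedPotential.isDiracData (hv : IsBoundedPotential l M v) :
    IsDiracData (toOp m₁ m₂ (jMat m₁ m₂)) l M (fun x => toOp m₁ m₂ (VMat (v x))) where
  star_J := by
    rw [← map_star, Matrix.star_eq_conjTranspose]
    simp [jMat, Matrix.fromBlocks_conjTranspose]
  J_mul_J := by
    rw [← map_mul, ← map_one (toOp m₁ m₂)]
    congr 1
    simp [jMat, Matrix.fromBlocks_multiply]
  star_V x := by
    rw [← map_star, Matrix.star_eq_conjTranspose]
    simp [VMat, Matrix.fromBlocks_conjTranspose]
  anti x := by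
    rw [← map_mul, ← map_mul, ← map_neg]
    congr 1
    simp [jMat, VMat, Matrix.fromBlocks_multiply, Matrix.fromBlocks_neg]
  meas := by
    have h1 : AEStronglyMeasurable (fun x => fun i k => v x i k) (volume.restrict (Ioo 0 l)) :=
      (aemeasurable_pi_lambda _ fun i => aemeasurable_pi_lambda _ fun k =>
        hv.measurable i k).aestronglyMeasurable
    have h2 : Continuous fun A : Fin m₁ → Fin m₂ → ℂ => toOp m₁ m₂ (VMat (Matrix.of A)) := by
      refine (toOpIsometry m₁ m₂).continuous.comp ?_
      unfold VMat
      exact Continuous.matrix_fromBlocks continuous_const continuous_id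
        continuous_id.matrix_conjTranspose continuous_const
    exact h2.comp_aestronglyMeasurable h1
  bound x hx := (norm_VMat_le _).trans (hv.bound x hx)

lemma IsFundamentalSolution.isEvolution
    {u : ℝ → Matrix (Fin m₁ ⊕ Fin m₂) (Fin m₁ ⊕ Fin m₂) ℂ} (hu : IsFundamentalSolution l v z u) :
    IsEvolution (toOp m₁ m₂ (jMat m₁ m₂)) l (fun x => toOp m₁ m₂ (VMat (v x))) z
      (fun x => toOp m₁ m₂ (u x)) where
  continuousOn := (toOpIsometry m₁ m₂).continuous.comp_continuousOn hu.continuousOn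
  eq x hx := by
    rw [hu.eq x hx, map_add, map_one, intervalIntegral.integral_of_le hx.1,
      intervalIntegral.integral_of_le hx.1, ← toOpIsometry_apply,
      ← LinearIsometry.integral_comp_comm]
    congr 1
    refine integral_congr_ae (Eventually.of_forall fun t => ?_)
    simp [toOpIsometry_apply, gen]

/-- The operator form of a `m₂ × m₁` matrix, from the first to the second summand. -/
noncomputable def weylOp (m₁ m₂ : ℕ) : Matrix (Fin m₂) (Fin m₁) ℂ →ₗ[ℂ]
    (EuclideanSpace ℂ (Fin m₁ ⊕ Fin m₂) →L[ℂ] EuclideanSpace ℂ (Fin m₁ ⊕ Fin m₂)) where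
  toFun A := toOp m₁ m₂ (Matrix.fromBlocks 0 0 A 0)
  map_add' A B := by rw [← map_add, Matrix.fromBlocks_add]; simp
  map_smul' c A := by rw [RingHom.id_apply, ← map_smul, Matrix.fromBlocks_smul]; simp

lemma reInner_jMat_mulVec_nonneg {Q : Matrix (Fin m₁ ⊕ Fin m₂) (Fin m₁) ℂ}
    (hQ : IsNonsingularJNonneg Q) (b : Fin m₁ → ℂ) :
    0 ≤ reInner (toOp m₁ m₂ (jMat m₁ m₂) (toLp 2 (Q *ᵥ b))) (toLp 2 (Q *ᵥ b)) := by
  have h := (Complex.le_def.1 (hQ.2.dotProduct_mulVec_nonneg b)).1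
  rw [reInner_comm, reInner_apply, EuclideanSpace.inner_eq_star_dotProduct]
  refine h.trans_eq (congrArg Complex.re ?_)
  rw [Matrix.toEuclideanCLM_toLp, Matrix.star_mulVec, ← Matrix.mulVec_mulVec,
    ← Matrix.mulVec_mulVec, Matrix.dotProduct_mulVec (star b), dotProduct_comm]

lemma fromCols_one_zero_mul {n : Type*} [Fintype n]
    (X : Matrix (Fin m₁ ⊕ Fin m₂) n ℂ) :
    (Matrix.fromCols 1 0 : Matrix (Fin m₁) (Fin m₁ ⊕ Fin m₂) ℂ) * X = X.toRows₁ := by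
  conv_lhs => rw [← Matrix.fromRows_toRows X]
  rw [Matrix.fromCols_mul_fromRows]
  simp

lemma fromCols_zero_one_mul {n : Type*} [Fintype n]
    (X : Matrix (Fin m₁ ⊕ Fin m₂) n ℂ) :
    (Matrix.fromCols 0 1 : Matrix (Fin m₂) (Fin m₁ ⊕ Fin m₂) ℂ) * X = X.toRows₂ := by
  conv_lhs => rw [← Matrix.fromRows_toRows X]
  rw [Matrix.fromCols_mul_fromRows]
  simp

/-- The Weyl property at one point of the half-plane, in operator form. The denominator of the
Möbius transformation is invertible: a null vector would give a solution that starts in the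
eigenspace `J = -1` and reaches the nonnegative cone. -/
lemma isWeylOperator_of_mem_mobiusSet (hv : IsBoundedPotential l M v) (hl : 0 ≤ l)
    {u : ℝ → Matrix (Fin m₁ ⊕ Fin m₂) (Fin m₁ ⊕ Fin m₂) ℂ}
    (hu : ∀ z, ∃ u, IsFundamentalSolution l v z u)
    (hz : M < z.im) (huz : IsFundamentalSolution l v z u)
    {A : Matrix (Fin m₂) (Fin m₁) ℂ} (hA : A ∈ mobiusSet M (u l) z) :
    IsWeylOperator (toOp m₁ m₂ (jMat m₁ m₂)) l (fun x => toOp m₁ m₂ (u x)) (weylOp m₁ m₂ A) := by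
  obtain ⟨P, -, -, hQ, hAQ⟩ := hA
  set Q := P z with hQdef
  have hU := huz.isEvolution
  have hD := hv.isDiracData
  have hll : l ∈ Icc 0 l := ⟨hl, le_rfl⟩
  obtain ⟨u', hu'⟩ := hu (conj z)
  have hinv : u l * star (u' l) = 1 := by
    refine EquivLike.injective (toOp m₁ m₂) ?_
    rw [map_mul, map_star, map_one]
    exact hu'.isEvolution.mul_star_self hD hU hll
  have hunit : u l * (u l)⁻¹ = 1 := by rw [Matrix.inv_eq_right_inv hinv, hinv]
  set B := (u l)⁻¹ * Q with hB
  have huB : u l * B = Q := by rw [hB, ← Matrix.mul_assoc, hunit, Matrix.one_mul]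
  have hBr : ∀ b, ofLp (toLp 2 (B *ᵥ b) : EuclideanSpace ℂ (Fin m₁ ⊕ Fin m₂)) =
      Sum.elim (B.toRows₁ *ᵥ b) (B.toRows₂ *ᵥ b) := by
    intro b
    change B *ᵥ b = _
    conv_lhs => rw [← Matrix.fromRows_toRows B]
    rw [Matrix.fromRows_mulVec]
  have huBb : ∀ b, toOp m₁ m₂ (u l) (toLp 2 (B *ᵥ b)) = toLp 2 (Q *ᵥ b) := by
    intro b
    rw [Matrix.toEuclideanCLM_toLp, Matrix.mulVec_mulVec, huB]
  have hdet : B.toRows₁.det ≠ 0 := by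
    intro hdet
    obtain ⟨b, hb0, hb⟩ := Matrix.exists_mulVec_eq_zero_iff.2 hdet
    set w : EuclideanSpace ℂ (Fin m₁ ⊕ Fin m₂) := toLp 2 (B *ᵥ b) with hw
    have hJw : toOp m₁ m₂ (jMat m₁ m₂) w = -w := by
      apply ofLp_injective
      rw [Matrix.ofLp_toEuclideanCLM, ofLp_neg, hBr, hb, jMat, Matrix.fromBlocks_mulVec]
      ext i; rcases i with i | i <;> simp [Matrix.neg_mulVec]
    have h1 := (hU.isEnergyPair hD w).s_antitoneOn hz.le ⟨le_rfl, hl⟩ hll hl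
    simp only [hU.zero hl, one_apply_eq_self, hJw, map_neg, _root_.neg_apply, reInner_self] at h1
    have h2 := reInner_jMat_mulVec_nonneg hQ b
    rw [← huBb] at h2
    have hw0 : w = 0 := by
      have : ‖w‖ ^ 2 = 0 := le_antisymm (by linarith) (sq_nonneg _)
      simpa using this
    have hBb : B *ᵥ b = 0 := by simpa [hw] using hw0
    have hQb : Q *ᵥ b = 0 := by rw [← huB, ← Matrix.mulVec_mulVec, hBb, Matrix.mulVec_zero]
    have h3 := hQ.1.dotProduct_mulVec_pos hb0
    rw [← Matrix.mulVec_mulVec, hQb] at h3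
    simp at h3
  have hA' : A = B.toRows₂ * B.toRows₁⁻¹ := by
    rw [hAQ, mobius, Matrix.mul_assoc _ (u l)⁻¹ Q, Matrix.mul_assoc _ (u l)⁻¹ Q, ← hB,
      fromCols_one_zero_mul, fromCols_zero_one_mul]
  have hBB : B.toRows₁ * B.toRows₁⁻¹ = 1 :=
    Matrix.mul_nonsing_inv _ (isUnit_iff_ne_zero.2 hdet)
  refine ⟨fun p _ => ?_, fun p hp => ?_⟩
  · have : jMat m₁ m₂ * Matrix.fromBlocks 0 0 A 0 = -Matrix.fromBlocks 0 0 A 0 := by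
      simp [jMat, Matrix.fromBlocks_multiply, Matrix.fromBlocks_neg]
    have h := congr(toOp m₁ m₂ $this p)
    rw [map_mul, map_neg] at h
    exact h
  · have hp2 : ofLp p = Sum.elim (fun i => p (Sum.inl i)) 0 := by
      have h := congr(ofLp $hp)
      rw [Matrix.ofLp_toEuclideanCLM] at h
      ext i
      rcases i with i | i
      · rfl
      · have h1 := congr($h (Sum.inr i))
        simp [jMat, Matrix.mulVec, dotProduct, Matrix.one_apply] at h1
        exact self_eq_neg.1 h1.symm
    set a : Fin m₁ → ℂ := fun i => p (Sum.inl i)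
    have hpa : p + weylOp m₁ m₂ A p = toLp 2 (B *ᵥ (B.toRows₁⁻¹ *ᵥ a)) := by
      apply ofLp_injective
      have hw : ofLp (weylOp m₁ m₂ A p) = Matrix.fromBlocks 0 0 A 0 *ᵥ ofLp p := rfl
      rw [ofLp_add, hw, hBr, Matrix.mulVec_mulVec, Matrix.mulVec_mulVec, hBB, ← hA', hp2,
        Matrix.fromBlocks_mulVec]
      ext i; rcases i with i | i <;> simp
    rw [hpa, huBb]
    exact reInner_jMat_mulVec_nonneg hQ _

end Matrices

end SkewDirac

theorem mainTheorem2 {m₁ m₂ : ℕ} (l M : ℝ) (hM : 0 < M)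
    (v v' : ℝ → Matrix (Fin m₁) (Fin m₂) ℂ)
    (hv : SkewDirac.IsBoundedPotential l M v) (hv' : SkewDirac.IsBoundedPotential l M v')
    (φ φ' : ℂ → Matrix (Fin m₂) (Fin m₁) ℂ)
    (hφ : SkewDirac.IsWeylFunction l M v φ) (hφ' : SkewDirac.IsWeylFunction l M v' φ')
    (r₀ : ℝ) (hr₀ : 0 < r₀) (hr₀l : r₀ ≤ l) (c : ℝ)
    (h : ∀ r : ℝ, 0 < r → r < r₀ →
      (fun z => φ z - φ' z) =O[SkewDirac.rayAtInfty c]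
        (fun z : ℂ => Complex.exp (2 * Complex.I * r * z))) :
    ∀ᵐ x ∂(volume : Measure ℝ), x ∈ Ioo 0 r₀ → v x = v' x := by
  have hl : 0 ≤ l := hr₀.le.trans hr₀l
  obtain ⟨-, u, hu, hφu⟩ := hφ
  obtain ⟨-, u', hu', hφu'⟩ := hφ'
  have key := SkewDirac.potential_eq_of_weyl hM hv.isDiracData hv'.isDiracData
    (W := fun x z => SkewDirac.toOp m₁ m₂ (u x z)) (W' := fun x z => SkewDirac.toOp m₁ m₂ (u' x z))
    (Φ := fun z => SkewDirac.weylOp m₁ m₂ (φ z)) (Φ' := fun z => SkewDirac.weylOp m₁ m₂ (φ' z))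
    (fun z => (hu z).isEvolution) (fun z => (hu' z).isEvolution)
    (fun z hz => SkewDirac.isWeylOperator_of_mem_mobiusSet hv hl (fun z => ⟨_, hu z⟩) hz (hu z)
      (hφu z hz))
    (fun z hz => SkewDirac.isWeylOperator_of_mem_mobiusSet hv' hl (fun z => ⟨_, hu' z⟩) hz (hu' z)
      (hφu' z hz)) hr₀ hr₀l (c := c) (fun x hx hxr => by
        refine IsBigO.trans ?_ (h x hx hxr)
        simp only [← map_sub]
        exact (LinearMap.toContinuousLinearMap (SkewDirac.weylOp m₁ m₂)).isBigO_comp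
          (fun z => φ z - φ' z) _)
  filter_upwards [key] with x hx hxr
  have hV : SkewDirac.VMat (v x) = SkewDirac.VMat (v' x) :=
    (SkewDirac.toOp m₁ m₂).injective (hx hxr)
  exact (Matrix.fromBlocks_inj.1 hV).2.1
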